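/- Let $G$ be a locally compact (Hausdorff) group, $N$ a closed normal subgroup of $G$, and $\lambda_G$, $\lambda_N$, $\lambda_{G/N}$ left Haar (Radon) measures on $G$, $N$, $G/N$, normalized by Weil's formula $\int_{G/N}\int_N f(xs)\,d\lambda_N(s)\,d\lambda_{G/N}(xN)=\int_G f\,d\lambda_G$ for $f\in C_c(G)$. Let $\xi:N\to\mathbb{T}$ be a $G$-invariant character, i.e. a continuous homomorphism with $\xi(x^{-1}sx)=\xi(s)$ for all $x\in G$, $s\in N$ (we write $\xi\in\Gamma(G,N)$). Let $C_\xi(G,N)$ be the space of continuous $\psi:G\to\mathbb{C}$ such that $\psi(xs)=\xi(s)\psi(x)$ for all $x\in G$, $s\in N$ and the image of $\operatorname{supp}\psi$ in $G/N$ is compact, with the norm $\|\psi\|_{(1)}=\int_{G/N}|\psi(y)|\,d\lambda_{G/N}(yN)$, the product $(\psi\natural\phi)(x)=\int_{G/N}\psi(y)\phi(y^{-1}x)\,d\lambda_{G/N}(yN)$ and the involution $\psi^\natural(x)=\Delta_{G/N}(x^{-1}N)\overline{\psi(x^{-1})}$. Let $L^1_\xi(G,N)$ be its Banach completion, with the continuous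 extensions of this product and involution. Let $L^1(G)=L^1(G,\lambda_G)$ carry the continuous extensions of the convolution $(f*g)(x)=\int_G f(y)g(y^{-1}x)\,d\lambda_G(y)$ and of the involution $f^*(x)=\Delta_G(x^{-1})\overline{f(x^{-1})}$ of $C_c(G)$. Here the modular function $\Delta_H$ of a locally compact group $H$ is normalized by $\lambda_H(Ex)=\Delta_H(x)\lambda_H(E)$. Let $T_\xi:L^1(G)\to L^1_\xi(G,N)$ be the continuous linear extension of the map $T_\xi:C_c(G)\to C_\xi(G,N)$, $T_\xi(f)(x)=\int_N f(xs)\overline{\xi(s)}\,d\lambda_N(s)$, and let $\mathcal{N}^1_\xi(G,N)=\{f\in L^1(G):T_\xi(f)=0\}$. Then all these continuous extensions exist, $L^1(G)$ and $L^1_\xi(G,N)$ are Banach $*$-algebras (with submultiplicative norm and isometric involution), and: 1. $T_\xi:L^1(G)\to L^1_\xi(G,N)$ is a contractive $*$-homomorphism: it is linear, $\|T_\xi(f)\|_{(1)}\le\|f\|_{L^1(G)}$, $T_\xi(f*g)=T_\xi(f)\natural T_\xi(g)$ and $T_\xi(f^*)=T_\xi(f)^\natural$ for all $f,g\in L^1(G)$.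 2. $\mathcal{N}^1_\xi(G,N)$ is a closed two-sided $*$-ideal of $L^1(G)$. 3. With the quotient norm and the induced product and involution, $L^1(G)/\mathcal{N}^1_\xi(G,N)$ is a Banach $*$-algebra, and $f+\mathcal{N}^1_\xi(G,N)\mapsto T_\xi(f)$ is an isometric $*$-isomorphism of it onto $L^1_\xi(G,N)$. -/

import Mathlib

open MeasureTheory Measure Filter Topology
open scoped CompactlySupported ComplexConjugate Pointwise

set_option linter.unusedSectionVars false

noncomputable section

namespace CovariantAlgebra

/-! ### Continuous bilinear extension, Banach *-algebras -/

/-- The extension by continuity of a two-variable map `b` along a map `i` with dense range: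
`extendBilin i j b F H` is the limit of `j (b f h)` as `(i f, i h)` tends to `(F, H)`. -/
def extendBilin {A X : Type*} [TopologicalSpace X] (i : A → X) (b : A → A → A) (F H : X) : X :=
  haveI : Nonempty X := ⟨F⟩
  limUnder (comap (Prod.map i i) (𝓝 (F, H))) fun p : A × A => i (b p.1 p.2)

/-- The (semi)normed space `A`, with the product `mul` and the involution `inv`, is a complex
Banach *-algebra with isometric involution. -/
structure IsBanachStarAlgebra (A : Type*) [SeminormedAddCommGroup A] [NormedSpace ℂ A]
    (mul : A → A → A) (inv : A → A) : Prop where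
  eq_zero_of_norm : ∀ a : A, ‖a‖ = 0 → a = 0
  complete : CompleteSpace A
  add_mul : ∀ a b c, mul (a + b) c = mul a c + mul b c
  mul_add : ∀ a b c, mul a (b + c) = mul a b + mul a c
  smul_mul : ∀ (t : ℂ) a b, mul (t • a) b = t • mul a b
  mul_smul : ∀ (t : ℂ) a b, mul a (t • b) = t • mul a b
  mul_assoc : ∀ a b c, mul (mul a b) c = mul a (mul b c)
  norm_mul_le : ∀ a b, ‖mul a b‖ ≤ ‖a‖ * ‖b‖
  inv_add : ∀ a b, inv (a + b) = inv a + inv b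
  inv_smul : ∀ (t : ℂ) a, inv (t • a) = conj t • inv a
  inv_inv : ∀ a, inv (inv a) = a
  inv_mul : ∀ a b, inv (mul a b) = mul (inv b) (inv a)
  norm_inv : ∀ a, ‖inv a‖ = ‖a‖

/-- `T` is a contractive *-homomorphism for the given products and involutions. -/
structure IsContractiveStarHom {A B : Type*} [SeminormedAddCommGroup A] [NormedSpace ℂ A]
    [SeminormedAddCommGroup B] [NormedSpace ℂ B] (mulA : A → A → A) (invA : A → A)
    (mulB : B → B → B) (invB : B → B) (T : A →ₗ[ℂ] B) : Prop where
  norm_le : ∀ a, ‖T a‖ ≤ ‖a‖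
  map_mul : ∀ a b, T (mulA a b) = mulB (T a) (T b)
  map_inv : ∀ a, T (invA a) = invB (T a)

/-- `S` is a closed two-sided *-ideal for the given product and involution. -/
structure IsClosedStarIdeal {A : Type*} [SeminormedAddCommGroup A] [NormedSpace ℂ A]
    (mul : A → A → A) (inv : A → A) (S : Submodule ℂ A) : Prop where
  isClosed : IsClosed (S : Set A)
  mul_mem_left : ∀ a, ∀ b ∈ S, mul a b ∈ S
  mul_mem_right : ∀ a ∈ S, ∀ b, mul a b ∈ S
  inv_mem : ∀ a ∈ S, inv a ∈ S

/-- The product `[a] [b] = [a b]` of the quotient `A ⧸ S` (well defined if `S` is an ideal). -/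
def quotientMul {A : Type*} [AddCommGroup A] [Module ℂ A] (mul : A → A → A) (S : Submodule ℂ A)
    (p q : A ⧸ S) : A ⧸ S :=
  Submodule.Quotient.mk (mul (Quotient.out p) (Quotient.out q))

/-- The involution `[a]^* = [a^*]` of the quotient `A ⧸ S` (well defined if `S` is a *-ideal). -/
def quotientInv {A : Type*} [AddCommGroup A] [Module ℂ A] (inv : A → A) (S : Submodule ℂ A)
    (p : A ⧸ S) : A ⧸ S :=
  Submodule.Quotient.mk (inv (Quotient.out p))

/-! ### The modular function -/

section Modular

variable {G : Type*} [Group G] [TopologicalSpace G] [IsTopologicalGroup G] [LocallyCompactSpace G]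

/-- The modular function `Δ` of `G`, normalised by `λ (E x) = Δ x * λ E` for left Haar measures `λ`
(equivalently `∫ f (y x) dλ(y) = Δ (x⁻¹) ∫ f dλ`). Mathlib's `modularCharacter` is the inverse
of this function. -/
def modular (x : G) : ℝ := ((modularCharacter x : NNReal) : ℝ)⁻¹

theorem integral_comp_mul_right [MeasurableSpace G] [BorelSpace G] (μ : Measure G)
    [μ.IsHaarMeasure] (f : G → ℝ) (hf : Continuous f) (hc : HasCompactSupport f) (x : G) :
    ∫ y, f (y * x) ∂μ = modular x⁻¹ * ∫ y, f y ∂μ := by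
  have h1 : modular x⁻¹ = ((haarScalarFactor (map (· * x) μ) μ : NNReal) : ℝ) := by
    rw [modular, map_inv, NNReal.coe_inv, inv_inv, ← modularCharacterFun_eq_haarScalarFactor]
    rfl
  have h2 := integral_isMulLeftInvariant_eq_smul_of_hasCompactSupport (map (· * x) μ) μ hf hc
  rw [integral_map (by fun_prop) (by fun_prop)] at h2
  rw [h2, h1, integral_smul_nnreal_measure]
  rfl

theorem continuous_modular : Continuous (modular : G → ℝ) := by
  borelize G
  let μ : Measure G := haar
  obtain ⟨⟨f, f_cont⟩, f_comp, f_nonneg, f_one⟩ :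
    ∃ f : C(G, ℝ), HasCompactSupport f ∧ 0 ≤ f ∧ f 1 ≠ 0 := exists_continuous_nonneg_pos 1
  have hpos : 0 < ∫ y, f y ∂μ :=
    f_cont.integral_pos_of_hasCompactSupport_nonneg_nonzero f_comp f_nonneg f_one
  have key : Continuous fun x : G => ∫ y, f (y * x) ∂μ := by
    refine continuous_iff_continuousAt.2 fun x₀ => ?_
    obtain ⟨t, t_comp, ht⟩ := exists_compact_mem_nhds x₀
    refine ContinuousOn.continuousAt (s := t) ?_ ht
    refine continuousOn_integral_of_compact_support (f := fun x y => f (y * x))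
      (IsCompact.mul f_comp t_comp.inv) ?_ ?_
    · exact (f_cont.comp (continuous_snd.mul continuous_fst)).continuousOn
    · intro p x hp hx
      contrapose! hx
      exact ⟨x * p, subset_tsupport _ hx, p⁻¹, by simpa using hp, by simp⟩
  have h3 : (modular : G → ℝ) = fun x => (∫ y, f (y * x⁻¹) ∂μ) / ∫ y, f y ∂μ := by
    funext x
    rw [integral_comp_mul_right μ f f_cont f_comp, inv_inv, mul_div_cancel_right₀ _ hpos.ne']
  rw [h3]
  exact (key.comp continuous_inv).div_const _

end Modular

/-! ### The group algebra `L¹(G)` -/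

section GroupAlgebra

variable {G : Type*} [Group G] [TopologicalSpace G] [IsTopologicalGroup G] [LocallyCompactSpace G]
  [MeasurableSpace G] [BorelSpace G]

/-- The convolution `(f * g)(x) = ∫ f(y) g(y⁻¹x) dλ(y)` on `C_c(G)`. -/
def convCc (μ : Measure G) [μ.IsHaarMeasure] (f g : C_c(G, ℂ)) : C_c(G, ℂ) where
  toFun x := ∫ y, f y * g (y⁻¹ * x) ∂μ
  continuous_toFun := by
    rw [← continuousOn_univ]
    refine continuousOn_integral_of_compact_support (f := fun x y => f y * g (y⁻¹ * x))
      (k := tsupport f) f.hasCompactSupport ?_ ?_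
    · exact Continuous.continuousOn ((map_continuous f).comp continuous_snd |>.mul
        ((map_continuous g).comp (continuous_snd.inv.mul continuous_fst)))
    · intro p x _ hx
      simp [image_eq_zero_of_notMem_tsupport hx]
  hasCompactSupport' := by
    refine HasCompactSupport.intro (K := tsupport f * tsupport g)
      (IsCompact.mul f.hasCompactSupport g.hasCompactSupport) fun x hx => ?_
    refine integral_eq_zero_of_ae (Eventually.of_forall fun y => ?_)
    by_cases hy : y ∈ tsupport f
    · have : y⁻¹ * x ∉ tsupport g := fun h => hx ⟨y, hy, _, h, by simp⟩
      simp [image_eq_zero_of_notMem_tsupport this]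
    · simp [image_eq_zero_of_notMem_tsupport hy]

/-- The involution `f^*(x) = Δ(x⁻¹) conj (f (x⁻¹))` on `C_c(G)`. -/
def involCc : C_c(G, ℂ) →ₗ⋆[ℂ] C_c(G, ℂ) where
  toFun f :=
    { toFun := fun x => (modular x⁻¹ : ℂ) * conj (f x⁻¹)
      continuous_toFun := by
        have h1 := (continuous_modular (G := G)).comp continuous_inv
        have h2 := (map_continuous f).comp (continuous_inv (G := G))
        exact (Complex.continuous_ofReal.comp h1).mul (Complex.continuous_conj.comp h2)
      hasCompactSupport' := by
        refine HasCompactSupport.intro (K := (tsupport f)⁻¹)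
          (IsCompact.inv f.hasCompactSupport) fun x hx => ?_
        rw [Set.mem_inv] at hx
        simp [image_eq_zero_of_notMem_tsupport hx] }
  map_add' f g := by
    ext x
    simp [mul_add]
  map_smul' t f := by
    ext x
    simp [mul_left_comm]

/-- The canonical map `C_c(G) → L¹(G)`. -/
def toL1 (μ : Measure G) [μ.IsHaarMeasure] : C_c(G, ℂ) →ₗ[ℂ] Lp ℂ 1 μ where
  toFun f := ((map_continuous f).memLp_of_hasCompactSupport f.hasCompactSupport).toLp f
  map_add' _ _ := rfl
  map_smul' _ _ := rfl

/-- The convolution of `L¹(G)`: the continuous extension of the convolution of `C_c(G)`. -/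
def convL1 (μ : Measure G) [μ.IsHaarMeasure] : Lp ℂ 1 μ → Lp ℂ 1 μ → Lp ℂ 1 μ :=
  extendBilin (toL1 μ) (convCc μ)

/-- The involution of `L¹(G)`: the continuous extension of the involution of `C_c(G)`. -/
def involL1 (μ : Measure G) [μ.IsHaarMeasure] : Lp ℂ 1 μ →L⋆[ℂ] Lp ℂ 1 μ :=
  LinearMap.extendOfNorm ((toL1 μ).comp (involCc (G := G))) (toL1 μ)

end GroupAlgebra

/-! ### Covariant functions -/

section Covariant

variable {G : Type*} [Group G] [TopologicalSpace G] [IsTopologicalGroup G] {N : Subgroup G}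

/-- `ψ(xk) = ξ(k) ψ(x)` for all `x ∈ G` and `k ∈ N`. -/
def IsCovariant (ξ : N →ₜ* Circle) (ψ : G → ℂ) : Prop :=
  ∀ (x : G) (k : N), ψ (x * k) = (ξ k : ℂ) * ψ x

/-- The `G`-invariant characters of `N`: `ξ(x⁻¹ s x) = ξ(s)` for all `x ∈ G`, `s ∈ N`. -/
def invariantCharacters (N : Subgroup G) [N.Normal] : Set (N →ₜ* Circle) :=
  {ξ | ∀ (x : G) (s : N), ξ (MulAut.conjNormal x⁻¹ s) = ξ s}

theorem IsCovariant.image_tsupport_eq {ξ : N →ₜ* Circle} {ψ : G → ℂ} (h : IsCovariant ξ ψ) :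
    ((↑) : G → G ⧸ N) '' tsupport ψ = closure (((↑) : G → G ⧸ N) '' Function.support ψ) := by
  have hs : ((↑) : G → G ⧸ N) ⁻¹' (((↑) : G → G ⧸ N) '' Function.support ψ)
      = Function.support ψ := by
    refine Set.Subset.antisymm ?_ (Set.subset_preimage_image _ _)
    rintro x ⟨y, hy, hyx⟩
    have hk : y⁻¹ * x ∈ N := QuotientGroup.eq.1 hyx
    have := h y ⟨y⁻¹ * x, hk⟩
    simp only [mul_inv_cancel_left] at this
    rw [Function.mem_support, this]
    exact mul_ne_zero (Circle.coe_ne_zero _) hy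
  have h2 := (QuotientGroup.isOpenMap_coe (N := N)).preimage_closure_eq_closure_preimage
    QuotientGroup.continuous_mk (((↑) : G → G ⧸ N) '' Function.support ψ)
  rw [hs] at h2
  rw [tsupport, ← h2, Set.image_preimage_eq _ QuotientGroup.mk_surjective]

theorem IsCovariant.isCompact_of_support [N.Normal] {ξ : N →ₜ* Circle} {ψ : G → ℂ}
    (h : IsCovariant ξ ψ) {K : Set (G ⧸ N)} (hK : IsCompact K)
    (hψ : ∀ x : G, (x : G ⧸ N) ∉ K → ψ x = 0) :
    IsCompact (((↑) : G → G ⧸ N) '' tsupport ψ) := by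
  rw [h.image_tsupport_eq]
  refine hK.closure_of_subset ?_
  rintro _ ⟨x, hx, rfl⟩
  by_contra hxK
  exact hx (hψ x hxK)

theorem notMem_imp_eq_zero {ψ : G → ℂ} (x : G)
    (hx : (x : G ⧸ N) ∉ ((↑) : G → G ⧸ N) '' tsupport ψ) : ψ x = 0 :=
  image_eq_zero_of_notMem_tsupport fun h => hx ⟨x, h, rfl⟩

/-- The space `C_ξ(G, N)` of continuous covariant functions `ψ` of `ξ` on `G` such that the image
of the support of `ψ` in `G/N` is compact. -/
def covariantSubmodule [N.Normal] (ξ : N →ₜ* Circle) : Submodule ℂ C(G, ℂ) where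
  carrier := {ψ | IsCompact (((↑) : G → G ⧸ N) '' tsupport ψ) ∧ IsCovariant ξ ψ}
  zero_mem' := by
    refine ⟨?_, fun x k => by simp⟩
    have : tsupport (⇑(0 : C(G, ℂ))) = ∅ := by simp
    rw [this]
    simp
  add_mem' := by
    rintro ψ φ ⟨h1, h2⟩ ⟨h3, h4⟩
    have hc : IsCovariant ξ (⇑(ψ + φ)) := fun x k => by
      simp only [ContinuousMap.add_apply, h2 x k, h4 x k, mul_add]
    refine ⟨hc.isCompact_of_support (h1.union h3) fun x hx => ?_, hc⟩
    rw [Set.mem_union, not_or] at hx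
    simp [notMem_imp_eq_zero x hx.1, notMem_imp_eq_zero x hx.2]
  smul_mem' := by
    rintro t ψ ⟨h1, h2⟩
    have hc : IsCovariant ξ (⇑(t • ψ)) := fun x k => by
      simp only [ContinuousMap.smul_apply, h2 x k, smul_eq_mul, mul_left_comm]
    refine ⟨hc.isCompact_of_support h1 fun x hx => ?_, hc⟩
    simp [notMem_imp_eq_zero x hx]

/-- `C_ξ(G, N)` as a normed space: the norm, defined below, depends on the measure `μQ` on `G/N`. -/
def CovFun [N.Normal] [MeasurableSpace (G ⧸ N)] (ξ : N →ₜ* Circle) (_μQ : Measure (G ⧸ N)) :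
    Type _ := covariantSubmodule ξ

/-- The integral `∫_{G/N} F(y) dμ(yN)` of a function `F` on `G` that is constant on the cosets of
`N` (so that the choice of representatives is irrelevant, see `apply_out`). -/
def cosetIntegral [MeasurableSpace (G ⧸ N)] {E : Type*} [NormedAddCommGroup E] [NormedSpace ℝ E]
    (μQ : Measure (G ⧸ N)) (F : G → E) : E :=
  ∫ z : G ⧸ N, F z.out ∂μQ

theorem apply_out {E : Type*} {F : G → E} (hF : ∀ (x : G) (s : N), F (x * s) = F x) (x : G) :
    F (x : G ⧸ N).out = F x := by
  obtain ⟨s, hs⟩ := QuotientGroup.mk_out_eq_mul N x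
  rw [hs, hF]

theorem continuous_out {E : Type*} [TopologicalSpace E] {F : G → E} (hc : Continuous F)
    (hF : ∀ (x : G) (s : N), F (x * s) = F x) : Continuous fun z : G ⧸ N => F z.out := by
  rw [(QuotientGroup.isQuotientMap_mk (N := N)).continuous_iff]
  exact hc.congr fun x => (apply_out hF x).symm

namespace CovFun

variable [N.Normal] [MeasurableSpace (G ⧸ N)] {ξ : N →ₜ* Circle} {μQ : Measure (G ⧸ N)}

instance : AddCommGroup (CovFun ξ μQ) := inferInstanceAs (AddCommGroup (covariantSubmodule ξ))

instance : Module ℂ (CovFun ξ μQ) := inferInstanceAs (Module ℂ (covariantSubmodule ξ))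

instance : FunLike (CovFun ξ μQ) G ℂ where
  coe ψ := ψ.1
  coe_injective _ _ h := Subtype.ext (DFunLike.coe_injective h)

theorem continuous (ψ : CovFun ξ μQ) : Continuous ψ := map_continuous ψ.1

theorem isCompact (ψ : CovFun ξ μQ) : IsCompact (((↑) : G → G ⧸ N) '' tsupport ψ) := ψ.2.1

theorem isCovariant (ψ : CovFun ξ μQ) : IsCovariant ξ ψ := ψ.2.2

theorem add_apply (ψ φ : CovFun ξ μQ) (x : G) : (ψ + φ) x = ψ x + φ x := rfl

theorem smul_apply (t : ℂ) (ψ : CovFun ξ μQ) (x : G) : (t • ψ) x = t * ψ x := rfl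

theorem neg_apply (ψ : CovFun ξ μQ) (x : G) : (-ψ) x = -ψ x := rfl

theorem zero_apply (x : G) : (0 : CovFun ξ μQ) x = 0 := rfl

theorem norm_apply_mul (ψ : CovFun ξ μQ) (x : G) (s : N) : ‖ψ (x * s)‖ = ‖ψ x‖ := by
  rw [ψ.isCovariant, norm_mul, Circle.norm_coe, one_mul]

theorem out_eq_zero (ψ : CovFun ξ μQ) (z : G ⧸ N)
    (hz : z ∉ ((↑) : G → G ⧸ N) '' tsupport ψ) : ψ z.out = 0 :=
  notMem_imp_eq_zero (N := N) _ (by rwa [QuotientGroup.out_eq'])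

theorem continuous_norm_out (ψ : CovFun ξ μQ) : Continuous fun z : G ⧸ N => ‖ψ z.out‖ :=
  continuous_out (F := fun x => ‖ψ x‖) ψ.continuous.norm ψ.norm_apply_mul

theorem hasCompactSupport_norm_out (ψ : CovFun ξ μQ) :
    HasCompactSupport fun z : G ⧸ N => ‖ψ z.out‖ :=
  HasCompactSupport.intro ψ.isCompact fun z hz => by rw [ψ.out_eq_zero z hz, norm_zero]

variable [BorelSpace (G ⧸ N)] [μQ.IsHaarMeasure]

/-- The norm `‖ψ‖ = ∫_{G/N} |ψ(y)| dμQ(yN)`. -/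
instance : Norm (CovFun ξ μQ) := ⟨fun ψ => cosetIntegral μQ fun y => ‖ψ y‖⟩

theorem norm_def (ψ : CovFun ξ μQ) : ‖ψ‖ = cosetIntegral μQ fun y => ‖ψ y‖ := rfl

theorem integrable_norm_out (ψ : CovFun ξ μQ) :
    Integrable (fun z : G ⧸ N => ‖ψ z.out‖) μQ :=
  ψ.continuous_norm_out.integrable_of_hasCompactSupport ψ.hasCompactSupport_norm_out

theorem normCore : NormedSpace.Core ℂ (CovFun ξ μQ) where
  norm_nonneg ψ := integral_nonneg fun z => norm_nonneg _
  norm_smul t ψ := by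
    simp only [norm_def, cosetIntegral, smul_apply, norm_mul, integral_const_mul]
  norm_triangle ψ φ := by
    simp only [norm_def, cosetIntegral]
    rw [← integral_add ψ.integrable_norm_out φ.integrable_norm_out]
    exact integral_mono (ψ + φ).integrable_norm_out
      (ψ.integrable_norm_out.add φ.integrable_norm_out) fun z => norm_add_le _ _
  norm_eq_zero_iff ψ := by
    constructor
    · intro h
      have h1 := (integral_eq_zero_iff_of_nonneg (fun z => norm_nonneg _)
        ψ.integrable_norm_out).1 h
      have h2 := (ψ.continuous_norm_out.ae_eq_iff_eq μQ continuous_const).1 h1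
      refine DFunLike.ext _ _ fun x => ?_
      have h3 : ‖ψ (x : G ⧸ N).out‖ = 0 := congrFun h2 (x : G ⧸ N)
      rw [apply_out (F := fun x => ‖ψ x‖) ψ.norm_apply_mul] at h3
      exact norm_eq_zero.1 h3
    · rintro rfl
      change ∫ _ : G ⧸ N, ‖(0 : ℂ)‖ ∂μQ = 0
      simp

instance : NormedAddCommGroup (CovFun ξ μQ) := NormedAddCommGroup.ofCore normCore

instance : NormedSpace ℂ (CovFun ξ μQ) := NormedSpace.ofCore normCore

end CovFun

end Covariant

/-! ### Covariant convolution and involution, and the space `L¹_ξ(G, N)` -/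

section CovariantOperations

variable {G : Type*} [Group G] [TopologicalSpace G] [IsTopologicalGroup G]
  {N : Subgroup G} [N.Normal] [MeasurableSpace (G ⧸ N)] [BorelSpace (G ⧸ N)]
  {ξ : N →ₜ* Circle} {μQ : Measure (G ⧸ N)} [μQ.IsHaarMeasure]

theorem CovFun.apply_left_mul (hξ : ξ ∈ invariantCharacters N) (ψ : CovFun ξ μQ) (s : N) (x : G) :
    ψ (s * x) = (ξ s : ℂ) * ψ x := by
  rw [← hξ x s, ← ψ.isCovariant]
  congr 1
  rw [MulAut.conjNormal_apply]
  group

/-- The integrand `y ↦ ψ(y) φ(y⁻¹x)` of the covariant convolution is constant on cosets. -/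
theorem CovFun.conv_integrand_mul (hξ : ξ ∈ invariantCharacters N) (ψ φ : CovFun ξ μQ) (x y : G)
    (s : N) : ψ (y * s) * φ ((y * s)⁻¹ * x) = ψ y * φ (y⁻¹ * x) := by
  have h1 : ((y * s)⁻¹ * x : G) = ((s⁻¹ : N) : G) * (y⁻¹ * x) := by
    simp [mul_assoc]
  rw [h1, φ.apply_left_mul hξ, ψ.isCovariant, map_inv]
  have h2 : (ξ s : ℂ) * ((ξ s)⁻¹ : Circle) = 1 := by
    rw [← Circle.coe_mul, mul_inv_cancel, Circle.coe_one]
  linear_combination (ψ y * φ (y⁻¹ * x)) * h2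

/-- The covariant convolution `(ψ ♮ φ)(x) = ∫_{G/N} ψ(y) φ(y⁻¹x) dμQ(yN)` on `C_ξ(G, N)`. -/
def covConv (hξ : ξ ∈ invariantCharacters N) (ψ φ : CovFun ξ μQ) : CovFun ξ μQ :=
  ⟨{ toFun := fun x => cosetIntegral μQ fun y => ψ y * φ (y⁻¹ * x)
     continuous_toFun := by
      rw [← continuousOn_univ]
      refine continuousOn_integral_of_compact_support
        (f := fun x (z : G ⧸ N) => ψ z.out * φ (z.out⁻¹ * x)) ψ.isCompact ?_ ?_
      · refine Continuous.continuousOn ?_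
        have hq := (IsOpenQuotientMap.id (X := G)).prodMap
          (QuotientGroup.isOpenQuotientMap_mk (N := N))
        rw [hq.isQuotientMap.continuous_iff]
        have hc : Continuous fun p : G × G => ψ p.2 * φ (p.2⁻¹ * p.1) :=
          (ψ.continuous.comp continuous_snd).mul
            (φ.continuous.comp (continuous_snd.inv.mul continuous_fst))
        refine hc.congr fun p => ?_
        exact (apply_out (F := fun y => ψ y * φ (y⁻¹ * p.1))
          (ψ.conv_integrand_mul hξ φ p.1) p.2).symm
      · intro x z _ hz
        simp [ψ.out_eq_zero z hz] }, by
    have hcov : IsCovariant ξ fun x => cosetIntegral μQ fun y => ψ y * φ (y⁻¹ * x) := by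
      intro x k
      simp only [cosetIntegral]
      rw [← integral_const_mul]
      refine integral_congr_ae (Eventually.of_forall fun z => ?_)
      simp only
      rw [← mul_assoc z.out⁻¹ x k, φ.isCovariant]
      ring
    refine ⟨hcov.isCompact_of_support (ψ.isCompact.mul φ.isCompact) fun x hx => ?_, hcov⟩
    refine integral_eq_zero_of_ae (Eventually.of_forall fun z => ?_)
    by_cases hz : z ∈ ((↑) : G → G ⧸ N) '' tsupport ψ
    · have : φ (z.out⁻¹ * x) = 0 := by
        refine notMem_imp_eq_zero (N := N) _ fun h => hx ⟨z, hz, _, h, ?_⟩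
        simp
      simp [this]
    · simp [ψ.out_eq_zero z hz]⟩

variable (ξ μQ) in
/-- `L¹_ξ(G, N)`: the Banach completion of `C_ξ(G, N)`. -/
abbrev CovL1 : Type _ := UniformSpace.Completion (CovFun ξ μQ)

variable (ξ μQ) in
/-- The canonical map `C_ξ(G, N) → L¹_ξ(G, N)`. -/
def toCovL1 : CovFun ξ μQ →ₗ[ℂ] CovL1 ξ μQ :=
  (UniformSpace.Completion.toComplL (𝕜 := ℂ) (E := CovFun ξ μQ)).toLinearMap

/-- The product of `L¹_ξ(G, N)`: the continuous extension of the covariant convolution. -/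
def covConvL1 (hξ : ξ ∈ invariantCharacters N) : CovL1 ξ μQ → CovL1 ξ μQ → CovL1 ξ μQ :=
  extendBilin (toCovL1 ξ μQ) (covConv hξ)

variable [LocallyCompactSpace G]

/-- The covariant involution `ψ^♮(x) = Δ_{G/N}(x⁻¹N) conj (ψ (x⁻¹))` on `C_ξ(G, N)`. -/
def covInvol (hξ : ξ ∈ invariantCharacters N) : CovFun ξ μQ →ₗ⋆[ℂ] CovFun ξ μQ where
  toFun ψ :=
    ⟨{ toFun := fun x => (modular ((x⁻¹ : G) : G ⧸ N) : ℂ) * conj (ψ x⁻¹)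
       continuous_toFun := by
        have h1 := (continuous_modular (G := G ⧸ N)).comp
          (QuotientGroup.continuous_mk.comp (continuous_inv (G := G)))
        have h2 := ψ.continuous.comp (continuous_inv (G := G))
        exact (Complex.continuous_ofReal.comp h1).mul (Complex.continuous_conj.comp h2) }, by
      have hcov : IsCovariant ξ fun x => (modular ((x⁻¹ : G) : G ⧸ N) : ℂ) * conj (ψ x⁻¹) := by
        intro x k
        have h1 : ((x * k)⁻¹ : G) = ((k⁻¹ : N) : G) * x⁻¹ := by simp
        have h2 : (((x * k)⁻¹ : G) : G ⧸ N) = ((x⁻¹ : G) : G ⧸ N) := by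
          rw [h1, QuotientGroup.mk_mul, (QuotientGroup.eq_one_iff _).2 (k⁻¹).2, one_mul]
        simp only
        rw [h2, h1, ψ.apply_left_mul hξ, map_mul, map_inv, Circle.coe_inv_eq_conj, Complex.conj_conj]
        ring
      refine ⟨hcov.isCompact_of_support ψ.isCompact.inv fun x hx => ?_, hcov⟩
      have : ψ x⁻¹ = 0 := notMem_imp_eq_zero (N := N) _ hx
      simp [this]⟩
  map_add' ψ φ := by
    refine DFunLike.ext _ _ fun x => ?_
    change _ * conj (ψ x⁻¹ + φ x⁻¹) = _ * conj (ψ x⁻¹) + _ * conj (φ x⁻¹)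
    rw [map_add, mul_add]
  map_smul' t ψ := by
    refine DFunLike.ext _ _ fun x => ?_
    change _ * conj (t * ψ x⁻¹) = conj t * (_ * conj (ψ x⁻¹))
    rw [map_mul, mul_left_comm]

/-- The involution of `L¹_ξ(G, N)`: the continuous extension of the covariant involution. -/
def covInvolL1 (hξ : ξ ∈ invariantCharacters N) : CovL1 ξ μQ →L⋆[ℂ] CovL1 ξ μQ :=
  LinearMap.extendOfNorm ((toCovL1 ξ μQ).comp (covInvol hξ)) (toCovL1 ξ μQ)

end CovariantOperations

/-! ### The operator `T_ξ` -/

section Operator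

variable {G : Type*} [Group G] [TopologicalSpace G] [IsTopologicalGroup G] [LocallyCompactSpace G]
  [MeasurableSpace G] [BorelSpace G] {N : Subgroup G} [N.Normal]
  [MeasurableSpace (G ⧸ N)] [BorelSpace (G ⧸ N)]

/-- Weil's formula `∫_{G/N} ∫_N f(xs) dμN(s) dμQ(xN) = ∫_G f dμG` for `f ∈ C_c(G)`, which normalises
the Haar measure `μQ` of `G/N` in terms of `μG` and `μN`. -/
def WeilFormula (μG : Measure G) (μN : Measure N) (μQ : Measure (G ⧸ N)) : Prop :=
  ∀ f : C_c(G, ℂ), cosetIntegral μQ (fun x => ∫ s : N, f (x * s) ∂μN) = ∫ x, f x ∂μG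

theorem continuous_slice (f : C_c(G, ℂ)) (ξ : N →ₜ* Circle) :
    Continuous fun p : G × N => f (p.1 * p.2) * conj (ξ p.2 : ℂ) := by
  have h1 : Continuous fun p : G × N => f (p.1 * p.2) :=
    (map_continuous f).comp (continuous_fst.mul (continuous_subtype_val.comp continuous_snd))
  have h2 : Continuous fun p : G × N => (ξ p.2 : ℂ) :=
    continuous_subtype_val.comp ((map_continuous ξ).comp continuous_snd)
  exact h1.mul (Complex.continuous_conj.comp h2)

theorem integrable_slice (hN : IsClosed (N : Set G)) (μN : Measure N) [μN.IsHaarMeasure]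
    (ξ : N →ₜ* Circle) (f : C_c(G, ℂ)) (x : G) :
    Integrable (fun s : N => f (x * s) * conj (ξ s : ℂ)) μN := by
  refine Continuous.integrable_of_hasCompactSupport
    ((continuous_slice f ξ).comp (Continuous.prodMk_right x)) ?_
  refine HasCompactSupport.intro (K := ((↑) : N → G) ⁻¹' ((x * ·) ⁻¹' tsupport f)) ?_ ?_
  · refine hN.isClosedEmbedding_subtypeVal.isCompact_preimage ?_
    exact (Homeomorph.mulLeft x).isClosedEmbedding.isCompact_preimage f.hasCompactSupport
  · intro s hs
    simp [image_eq_zero_of_notMem_tsupport hs]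

/-- The operator `T_ξ : C_c(G) → C_ξ(G, N)`, `T_ξ(f)(x) = ∫_N f(xs) conj (ξ(s)) dμN(s)`. -/
def covMap (hN : IsClosed (N : Set G)) (μN : Measure N) [μN.IsHaarMeasure] (ξ : N →ₜ* Circle)
    (μQ : Measure (G ⧸ N)) [μQ.IsHaarMeasure] : C_c(G, ℂ) →ₗ[ℂ] CovFun ξ μQ where
  toFun f :=
    ⟨{ toFun := fun x => ∫ s : N, f (x * s) * conj (ξ s : ℂ) ∂μN
       continuous_toFun := by
        refine continuous_iff_continuousAt.2 fun x₀ => ?_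
        obtain ⟨t, t_comp, ht⟩ := exists_compact_mem_nhds x₀
        refine ContinuousOn.continuousAt (s := t) ?_ ht
        refine continuousOn_integral_of_compact_support
          (f := fun x (s : N) => f (x * s) * conj (ξ s : ℂ))
          (hN.isClosedEmbedding_subtypeVal.isCompact_preimage
            (IsCompact.mul t_comp.inv f.hasCompactSupport)) ?_ ?_
        · exact (continuous_slice f ξ).continuousOn
        · intro x s hx hs
          have : f (x * s) = 0 := by
            refine image_eq_zero_of_notMem_tsupport fun h => hs ?_
            exact ⟨x⁻¹, by simpa using hx, _, h, by simp⟩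
          simp [this] }, by
      have hcov : IsCovariant ξ fun x => ∫ s : N, f (x * s) * conj (ξ s : ℂ) ∂μN := by
        intro x k
        simp only
        rw [← integral_mul_left_eq_self (μ := μN)
          (fun s : N => f (x * s) * conj (ξ s : ℂ)) k, ← integral_const_mul]
        refine integral_congr_ae (Eventually.of_forall fun s => ?_)
        have h2 : (ξ k : ℂ) * conj (ξ k : ℂ) = 1 := by
          rw [Complex.mul_conj, Circle.normSq_coe, Complex.ofReal_one]
        simp only [Subgroup.coe_mul, map_mul, Circle.coe_mul, mul_assoc]
        linear_combination (-(f (x * (k * s)) * conj (ξ s : ℂ))) * h2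
      refine ⟨hcov.isCompact_of_support
        (IsCompact.image f.hasCompactSupport QuotientGroup.continuous_mk) fun x hx => ?_, hcov⟩
      refine integral_eq_zero_of_ae (Eventually.of_forall fun s => ?_)
      have : f (x * s) = 0 := by
        refine image_eq_zero_of_notMem_tsupport fun h => hx ⟨_, h, ?_⟩
        rw [QuotientGroup.mk_mul, (QuotientGroup.eq_one_iff _).2 s.2, mul_one]
      simp [this]⟩
  map_add' f g := by
    refine DFunLike.ext _ _ fun x => ?_
    change ∫ s : N, (f (x * s) + g (x * s)) * conj (ξ s : ℂ) ∂μN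
      = (∫ s : N, f (x * s) * conj (ξ s : ℂ) ∂μN) + ∫ s : N, g (x * s) * conj (ξ s : ℂ) ∂μN
    simp only [add_mul]
    exact integral_add (integrable_slice hN μN ξ f x) (integrable_slice hN μN ξ g x)
  map_smul' t f := by
    refine DFunLike.ext _ _ fun x => ?_
    change ∫ s : N, (t * f (x * s)) * conj (ξ s : ℂ) ∂μN
      = t * ∫ s : N, f (x * s) * conj (ξ s : ℂ) ∂μN
    simp only [mul_assoc]
    exact integral_const_mul _ _

/-- The operator `T_ξ : L¹(G) → L¹_ξ(G, N)`: the continuous extension of `T_ξ` on `C_c(G)`. -/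
def covMapL1 (hN : IsClosed (N : Set G)) (μG : Measure G) [μG.IsHaarMeasure]
    (μN : Measure N) [μN.IsHaarMeasure] (ξ : N →ₜ* Circle)
    (μQ : Measure (G ⧸ N)) [μQ.IsHaarMeasure] : Lp ℂ 1 μG →L[ℂ] CovL1 ξ μQ :=
  LinearMap.extendOfNorm ((toCovL1 ξ μQ).comp (covMap hN μN ξ μQ)) (toL1 μG)

/-- The kernel of `T_ξ` in `L¹(G)`. -/
def covKer (hN : IsClosed (N : Set G)) (μG : Measure G) [μG.IsHaarMeasure]
    (μN : Measure N) [μN.IsHaarMeasure] (ξ : N →ₜ* Circle)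
    (μQ : Measure (G ⧸ N)) [μQ.IsHaarMeasure] : Submodule ℂ (Lp ℂ 1 μG) :=
  LinearMap.ker (covMapL1 hN μG μN ξ μQ).toLinearMap

end Operator

end CovariantAlgebra

end

open CovariantAlgebra

/-! Two facts about continuous functions carry the theorem. On C_c(G), the operator T_ξ respects
products and involutions and does not increase the L¹ norm. Conversely, every ψ in C_ξ(G, N) equals
T_ξ(f) for some f in C_c(G) with ‖f‖₁ = ‖ψ‖ (`exists_covMap_eq_integral_norm_eq`): take g ≥ 0 in
C_c(G) equal to 1 on a compact set whose image covers that of supp ψ, and divide g ψ by the fibre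
integral of g.

The bridge between G and G/N is Weil's formula applied to f h, where h(xs) = conj ξ(s) h(x): the
integral of f h over G is that of T_ξ(f) h over G/N (`cosetIntegral_covMap_mul`). With h(y) =
T_ξ(g)(y⁻¹x), which transforms correctly because ξ is G-invariant, it yields multiplicativity
(`covMap_convCc`). Compatibility with involutions (`covMap_involCc`) is proved weakly, by pairing
with covariant functions and using the inversion formula on G and on G/N; no relation between the
two modular functions is needed.

The rest is formal. Isometric lifts push every identity and estimate from C_c(G) down to C_ξ(G, N)
(`IsDenseStarCore.of_surjective`), and density extends the operations to the completions
(`IsDenseStarCore.isBanachStarAlgebra`). Successive approximation turns isometric lifts over a dense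
subspace into lifts of norm at most (1 + ε)‖y‖ over all of L¹_ξ(G, N)
(`exists_preimage_norm_le_of_dense`). Thus the quotient norm of a class is exactly the norm of its
image under T_ξ, and the quotient inherits its structure through the induced isometry. -/

noncomputable section

namespace CovariantAlgebra

/-! ### The modular function, convolution on C_c(G), and its density in L¹(G) -/

section GroupAlgebraLemmas

variable {G : Type*} [Group G] [TopologicalSpace G] [IsTopologicalGroup G] [LocallyCompactSpace G]

theorem modular_pos (x : G) : 0 < modular x :=
  inv_pos.2 (NNReal.coe_pos.2 (modularCharacterFun_pos x))

theorem modular_mul (x y : G) : modular (x * y) = modular x * modular y := by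
  simp only [modular, map_mul, NNReal.coe_mul, mul_inv]

theorem modular_inv (x : G) : modular x⁻¹ = (modular x)⁻¹ := by
  simp only [modular, map_inv, NNReal.coe_inv]

theorem modular_mul_modular_inv (x : G) : modular x * modular x⁻¹ = 1 := by
  rw [modular_inv, mul_inv_cancel₀ (modular_pos x).ne']

variable [MeasurableSpace G] [BorelSpace G]

/-- Inversion formula for Haar measures: `∫ Δ(x⁻¹) g(x⁻¹) dx = ∫ g(x) dx`. -/
theorem integral_modular_inv_smul_comp_inv (μ : Measure G) [μ.IsHaarMeasure] {E : Type*}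
    [NormedAddCommGroup E] [NormedSpace ℝ E] [CompleteSpace E] {g : G → E} (hg : Continuous g)
    (hc : HasCompactSupport g) : ∫ x, modular x⁻¹ • g x⁻¹ ∂μ = ∫ x, g x ∂μ := by
  obtain ⟨⟨f, f_cont⟩, f_comp, f_nonneg, f_one⟩ :
    ∃ f : C(G, ℝ), HasCompactSupport f ∧ 0 ≤ f ∧ f 1 ≠ 0 := exists_continuous_nonneg_pos 1
  have hpos : 0 < ∫ y, f y ∂μ :=
    f_cont.integral_pos_of_hasCompactSupport_nonneg_nonzero f_comp f_nonneg f_one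
  -- After multiplication by ∫ f, the factor Δ(y⁻¹) is absorbed as the effect of right translation
  -- on f. Two exchanges of integrals, legitimate by compact support without σ-finiteness, and two
  -- left translations then remove it.
  refine smul_right_injective E hpos.ne' ?_
  change (∫ y, f y ∂μ) • _ = (∫ y, f y ∂μ) • _
  calc (∫ y, f y ∂μ) • ∫ y, modular y⁻¹ • g y⁻¹ ∂μ
      = ∫ y, (∫ x, f (x * y) • g y⁻¹ ∂μ) ∂μ := by
        rw [← integral_smul]
        refine integral_congr_ae (Eventually.of_forall fun y => ?_)
        simp only
        rw [integral_smul_const, integral_comp_mul_right μ f f_cont f_comp, smul_smul, mul_comm]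
    _ = ∫ x, (∫ y, f (x * y) • g y⁻¹ ∂μ) ∂μ := by
        refine integral_integral_swap_of_hasCompactSupport
          (f := fun y x => f (x * y) • g y⁻¹) ?_ ?_
        · exact (f_cont.comp (continuous_snd.mul continuous_fst)).smul
            (hg.comp continuous_fst.inv)
        · refine HasCompactSupport.intro (K := (tsupport g)⁻¹ ×ˢ (tsupport f * tsupport g))
            (IsCompact.prod (IsCompact.inv hc) (IsCompact.mul f_comp hc)) ?_
          rintro ⟨y, x⟩ hyx
          by_contra h
          have h1 : x * y ∈ tsupport f :=
            subset_tsupport _ fun h0 => h (by simp [Function.uncurry, h0])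
          have h2 : y⁻¹ ∈ tsupport g :=
            subset_tsupport _ fun h0 => h (by simp [Function.uncurry, h0])
          exact hyx ⟨h2, x * y, h1, y⁻¹, h2, by simp⟩
    _ = ∫ x, (∫ y, f y • g (y⁻¹ * x) ∂μ) ∂μ := by
        refine integral_congr_ae (Eventually.of_forall fun x => ?_)
        simp only
        -- The substitution y ↦ xy turns g(y⁻¹x) into g(y⁻¹) and f(y) into f(xy).
        rw [← integral_mul_left_eq_self (μ := μ) (fun y => f y • g (y⁻¹ * x)) x]
        simp
    _ = ∫ y, (∫ x, f y • g (y⁻¹ * x) ∂μ) ∂μ := by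
        refine integral_integral_swap_of_hasCompactSupport
          (f := fun x y => f y • g (y⁻¹ * x)) ?_ ?_
        · exact (f_cont.comp continuous_snd).smul
            (hg.comp (continuous_snd.inv.mul continuous_fst))
        · refine HasCompactSupport.intro (K := (tsupport f * tsupport g) ×ˢ tsupport f)
            (IsCompact.prod (IsCompact.mul f_comp hc) f_comp) ?_
          rintro ⟨x, y⟩ hxy
          by_contra h
          have h1 : y ∈ tsupport f :=
            subset_tsupport _ fun h0 => h (by simp [Function.uncurry, h0])
          have h2 : y⁻¹ * x ∈ tsupport g :=
            subset_tsupport _ fun h0 => h (by simp [Function.uncurry, h0])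
          exact hxy ⟨⟨y, h1, _, h2, by simp⟩, h1⟩
    _ = (∫ y, f y ∂μ) • ∫ x, g x ∂μ := by
        rw [← integral_smul_const]
        refine integral_congr_ae (Eventually.of_forall fun y => ?_)
        simp only
        rw [integral_smul, integral_mul_left_eq_self (μ := μ) g]

theorem convCc_apply (μ : Measure G) [μ.IsHaarMeasure] (f g : C_c(G, ℂ)) (x : G) :
    convCc μ f g x = ∫ y, f y * g (y⁻¹ * x) ∂μ := rfl

theorem involCc_apply (f : C_c(G, ℂ)) (x : G) :
    involCc f x = (modular x⁻¹ : ℂ) * conj (f x⁻¹) := rfl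

theorem continuous_conv_integrand (f g : C_c(G, ℂ)) :
    Continuous fun p : G × G => f p.2 * g (p.2⁻¹ * p.1) :=
  ((map_continuous f).comp continuous_snd).mul
    ((map_continuous g).comp (continuous_snd.inv.mul continuous_fst))

theorem hasCompactSupport_conv_integrand (f g : C_c(G, ℂ)) :
    HasCompactSupport fun p : G × G => f p.2 * g (p.2⁻¹ * p.1) := by
  refine HasCompactSupport.intro (K := (tsupport f * tsupport g) ×ˢ tsupport f)
    (IsCompact.prod (IsCompact.mul f.hasCompactSupport g.hasCompactSupport) f.hasCompactSupport) ?_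
  rintro ⟨x, y⟩ hxy
  by_contra h
  have h1 : y ∈ tsupport f := subset_tsupport _ (left_ne_zero_of_mul h)
  have h2 : y⁻¹ * x ∈ tsupport g := subset_tsupport _ (right_ne_zero_of_mul h)
  exact hxy ⟨⟨y, h1, _, h2, by simp⟩, h1⟩

theorem integrable_conv_integrand (μ : Measure G) [μ.IsHaarMeasure] (f g : C_c(G, ℂ)) (x : G) :
    Integrable (fun y => f y * g (y⁻¹ * x)) μ := by
  refine Continuous.integrable_of_hasCompactSupport
    ((continuous_conv_integrand f g).comp (Continuous.prodMk_right x)) ?_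
  exact f.hasCompactSupport.mul_right

theorem CompactlySupported.integrable (μ : Measure G) [μ.IsHaarMeasure] (f : C_c(G, ℂ)) :
    Integrable f μ :=
  (map_continuous f).integrable_of_hasCompactSupport f.hasCompactSupport

theorem norm_toL1 (μ : Measure G) [μ.IsHaarMeasure] (f : C_c(G, ℂ)) :
    ‖toL1 μ f‖ = ∫ x, ‖f x‖ ∂μ := by
  change ‖((map_continuous f).memLp_of_hasCompactSupport f.hasCompactSupport).toLp f‖ = _
  rw [Lp.norm_toLp, eLpNorm_one_eq_lintegral_enorm,
    integral_norm_eq_lintegral_enorm (CompactlySupported.integrable μ f).aestronglyMeasurable]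

theorem convCc_add_left (μ : Measure G) [μ.IsHaarMeasure] (f g h : C_c(G, ℂ)) :
    convCc μ (f + g) h = convCc μ f h + convCc μ g h := by
  ext x
  simp only [convCc_apply, CompactlySupportedContinuousMap.add_apply, add_mul]
  exact integral_add (integrable_conv_integrand μ f h x) (integrable_conv_integrand μ g h x)

theorem convCc_add_right (μ : Measure G) [μ.IsHaarMeasure] (f g h : C_c(G, ℂ)) :
    convCc μ f (g + h) = convCc μ f g + convCc μ f h := by
  ext x
  simp only [convCc_apply, CompactlySupportedContinuousMap.add_apply, mul_add]
  exact integral_add (integrable_conv_integrand μ f g x) (integrable_conv_integrand μ f h x)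

theorem convCc_smul_left (μ : Measure G) [μ.IsHaarMeasure] (t : ℂ) (f g : C_c(G, ℂ)) :
    convCc μ (t • f) g = t • convCc μ f g := by
  ext x
  simp only [convCc_apply, CompactlySupportedContinuousMap.smul_apply, smul_eq_mul, mul_assoc]
  exact integral_const_mul _ _

theorem convCc_smul_right (μ : Measure G) [μ.IsHaarMeasure] (t : ℂ) (f g : C_c(G, ℂ)) :
    convCc μ f (t • g) = t • convCc μ f g := by
  ext x
  simp only [convCc_apply, CompactlySupportedContinuousMap.smul_apply, smul_eq_mul,
    mul_left_comm _ t]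
  exact integral_const_mul _ _

/-- Fubini for compactly supported integrands, followed by the left translation z ↦ yz in the inner
integral. -/
theorem convCc_assoc (μ : Measure G) [μ.IsHaarMeasure] (f g h : C_c(G, ℂ)) :
    convCc μ (convCc μ f g) h = convCc μ f (convCc μ g h) := by
  ext x
  calc ∫ z, (∫ y, f y * g (y⁻¹ * z) ∂μ) * h (z⁻¹ * x) ∂μ
      = ∫ z, (∫ y, f y * g (y⁻¹ * z) * h (z⁻¹ * x) ∂μ) ∂μ := by
        simp only [integral_mul_const]
    _ = ∫ y, (∫ z, f y * g (y⁻¹ * z) * h (z⁻¹ * x) ∂μ) ∂μ := by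
        refine integral_integral_swap_of_hasCompactSupport
          (f := fun z y => f y * g (y⁻¹ * z) * h (z⁻¹ * x)) ?_ ?_
        · exact (continuous_conv_integrand f g).mul
            ((map_continuous h).comp (continuous_fst.inv.mul continuous_const))
        · exact (hasCompactSupport_conv_integrand f g).mul_right
    _ = ∫ y, f y * (∫ z, g z * h (z⁻¹ * (y⁻¹ * x)) ∂μ) ∂μ := by
        refine integral_congr_ae (Eventually.of_forall fun y => ?_)
        simp only [mul_assoc]
        rw [integral_const_mul, ← integral_mul_left_eq_self (μ := μ) (fun z => g (y⁻¹ * z) * _) y]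
        simp [mul_assoc]

theorem integral_norm_convCc_le (μ : Measure G) [μ.IsHaarMeasure] (f g : C_c(G, ℂ)) :
    ∫ x, ‖convCc μ f g x‖ ∂μ ≤ (∫ x, ‖f x‖ ∂μ) * ∫ x, ‖g x‖ ∂μ := by
  have hcont : Continuous fun p : G × G => ‖f p.2 * g (p.2⁻¹ * p.1)‖ :=
    (continuous_conv_integrand f g).norm
  have hsupp : HasCompactSupport fun p : G × G => ‖f p.2 * g (p.2⁻¹ * p.1)‖ :=
    (hasCompactSupport_conv_integrand f g).norm
  -- Comparing Bochner integrals requires the majorant to be integrable; it is continuous and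
  -- supported in supp f · supp g.
  have hint : Integrable (fun x => ∫ y, ‖f y * g (y⁻¹ * x)‖ ∂μ) μ := by
    refine Continuous.integrable_of_hasCompactSupport ?_ ?_
    · rw [← continuousOn_univ]
      refine continuousOn_integral_of_compact_support
        (f := fun x y => ‖f y * g (y⁻¹ * x)‖) f.hasCompactSupport hcont.continuousOn ?_
      intro p x _ hx
      simp [image_eq_zero_of_notMem_tsupport hx]
    · refine HasCompactSupport.intro (K := tsupport f * tsupport g)
        (IsCompact.mul f.hasCompactSupport g.hasCompactSupport) fun x hx => ?_
      refine integral_eq_zero_of_ae (Eventually.of_forall fun y => ?_)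
      by_contra h
      have h' := norm_ne_zero_iff.1 h
      exact hx ⟨y, subset_tsupport _ (left_ne_zero_of_mul h'), _,
        subset_tsupport _ (right_ne_zero_of_mul h'), by simp⟩
  calc ∫ x, ‖convCc μ f g x‖ ∂μ ≤ ∫ x, (∫ y, ‖f y * g (y⁻¹ * x)‖ ∂μ) ∂μ :=
        integral_mono (CompactlySupported.integrable μ _).norm hint
          fun x => norm_integral_le_integral_norm _
    _ = ∫ y, (∫ x, ‖f y * g (y⁻¹ * x)‖ ∂μ) ∂μ :=
        integral_integral_swap_of_hasCompactSupport hcont hsupp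
    _ = ∫ y, ‖f y‖ * (∫ x, ‖g x‖ ∂μ) ∂μ := by
        refine integral_congr_ae (Eventually.of_forall fun y => ?_)
        simp only [norm_mul]
        rw [integral_const_mul, integral_mul_left_eq_self (μ := μ) (fun x => ‖g x‖)]
    _ = _ := integral_mul_const _ _

theorem involCc_involCc (f : C_c(G, ℂ)) : involCc (involCc f) = f := by
  ext x
  have h : (modular x⁻¹ : ℂ) * (modular x : ℂ) = 1 := by
    rw [mul_comm, ← Complex.ofReal_mul, modular_mul_modular_inv, Complex.ofReal_one]
  simp only [involCc_apply, inv_inv, map_mul, Complex.conj_ofReal, Complex.conj_conj]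
  rw [← mul_assoc, h, one_mul]

theorem involCc_convCc (μ : Measure G) [μ.IsHaarMeasure] (f g : C_c(G, ℂ)) :
    involCc (convCc μ f g) = convCc μ (involCc g) (involCc f) := by
  ext x
  rw [involCc_apply, convCc_apply, convCc_apply, ← integral_conj, ← integral_const_mul,
    ← integral_mul_left_eq_self (μ := μ) (fun y => involCc g y * _) x]
  refine integral_congr_ae (Eventually.of_forall fun y => ?_)
  -- The translation y ↦ xy has aligned the arguments of f and g on both sides. What remains is the
  -- cocycle identity Δ(y⁻¹x⁻¹) Δ(y) = Δ(x⁻¹).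
  have hxy : (x * y)⁻¹ * x = y⁻¹ := by group
  simp only [hxy]
  simp only [involCc_apply, map_mul, mul_inv_rev, inv_inv, modular_mul, Complex.ofReal_mul]
  have h : (modular y⁻¹ : ℂ) * (modular y : ℂ) = 1 := by
    rw [mul_comm, ← Complex.ofReal_mul, modular_mul_modular_inv, Complex.ofReal_one]
  linear_combination -(modular x⁻¹ : ℂ) * conj (f y) * conj (g (y⁻¹ * x⁻¹)) * h

theorem integral_norm_involCc (μ : Measure G) [μ.IsHaarMeasure] (f : C_c(G, ℂ)) :
    ∫ x, ‖involCc f x‖ ∂μ = ∫ x, ‖f x‖ ∂μ := by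
  rw [← integral_modular_inv_smul_comp_inv μ (map_continuous f).norm f.hasCompactSupport.norm]
  refine integral_congr_ae (Eventually.of_forall fun x => ?_)
  simp [involCc_apply, abs_of_pos (modular_pos x⁻¹)]

/-- By density of simple functions it suffices to treat c · 1_t with t of finite measure. Regularity
squeezes t between a compact s and an open u, and a Urysohn function that is 1 on s and supported in
u differs from 1_t only on u \ s, by at most 1. -/
theorem exists_hasCompactSupport_eLpNorm_one_sub_le {X E : Type*} [TopologicalSpace X] [R1Space X]
    [LocallyCompactSpace X] [MeasurableSpace X] [BorelSpace X] {μ : Measure X} [μ.Regular]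
    [NormedAddCommGroup E] [NormedSpace ℝ E] {f : X → E} (hf : MemLp f 1 μ) {ε : ENNReal}
    (hε : ε ≠ 0) :
    ∃ g : X → E, HasCompactSupport g ∧ eLpNorm (f - g) 1 μ ≤ ε ∧ Continuous g ∧ MemLp g 1 μ := by
  suffices H : ∃ g : X → E, eLpNorm (f - g) 1 μ ≤ ε ∧
      Continuous g ∧ MemLp g 1 μ ∧ HasCompactSupport g by
    obtain ⟨g, hg, g_cont, g_mem, g_support⟩ := H
    exact ⟨g, g_support, hg, g_cont, g_mem⟩
  apply hf.induction_dense ENNReal.one_ne_top _ _ _ _ hε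
  rotate_left
  · rintro f g ⟨f_cont, f_mem, hf⟩ ⟨g_cont, g_mem, hg⟩
    exact ⟨f_cont.add g_cont, f_mem.add g_mem, hf.add hg⟩
  · rintro f ⟨_, f_mem, _⟩
    exact f_mem.aestronglyMeasurable
  intro c t ht htμ ε hε
  -- The final error is ‖c‖ μ(u \ s), and u \ s is covered by u \ t and t \ s, each of measure below
  -- η. Hence η = ε / (2‖c‖), or any value when c = 0.
  obtain ⟨η, η_pos, hη⟩ : ∃ η : ENNReal, η ≠ 0 ∧ ‖c‖ₑ * (η + η) ≤ ε := by
    by_cases hc : c = 0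
    · exact ⟨1, one_ne_zero, by simp [hc]⟩
    · have hc' : ‖c‖ₑ ≠ 0 := by simpa using hc
      refine ⟨ε / ‖c‖ₑ / 2, ?_, ?_⟩
      · exact (ENNReal.half_pos (ENNReal.div_pos hε enorm_ne_top).ne').ne'
      · rw [ENNReal.add_halves, ENNReal.mul_div_cancel hc' enorm_ne_top]
  obtain ⟨s, st, s_compact, s_closed, μs⟩ := ht.exists_isCompact_isClosed_sdiff_lt htμ.ne η_pos
  obtain ⟨u, tu, u_open, -, μu⟩ := ht.exists_isOpen_sdiff_lt htμ.ne η_pos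
  obtain ⟨φ, φ_one, φ_comp, φ_supp, φ_mem⟩ :=
    exists_continuousMap_one_of_isCompact_subset_isOpen s_compact u_open (st.trans tu)
  have g_cont : Continuous fun x => φ x • c := (map_continuous φ).smul continuous_const
  have g_comp : HasCompactSupport fun x => φ x • c := HasCompactSupport.smul_right φ_comp
  refine ⟨fun x => φ x • c, ?_, g_cont, g_cont.memLp_of_hasCompactSupport g_comp, g_comp⟩
  have hmeas : MeasurableSet (u \ s) := u_open.measurableSet.diff s_closed.measurableSet
  calc eLpNorm ((fun x => φ x • c) - t.indicator fun _ => c) 1 μ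
      ≤ eLpNorm ((u \ s).indicator fun _ => c) 1 μ := by
        refine eLpNorm_mono fun x => ?_
        have h0 := (φ_mem x).1
        have h1 := (φ_mem x).2
        by_cases hxs : x ∈ s
        · have : φ x = 1 := φ_one hxs
          simp [this, st hxs, hxs]
        by_cases hxu : x ∈ u
        · rw [Set.indicator_of_mem (show x ∈ u \ s from ⟨hxu, hxs⟩)]
          by_cases hxt : x ∈ t
          · rw [Pi.sub_apply, Set.indicator_of_mem hxt, ← one_smul ℝ c, smul_smul, ← sub_smul,
              norm_smul, one_smul, mul_one, Real.norm_eq_abs, abs_sub_comm,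
              abs_of_nonneg (by linarith)]
            exact mul_le_of_le_one_left (norm_nonneg c) (by linarith)
          · rw [Pi.sub_apply, Set.indicator_of_notMem hxt, sub_zero, norm_smul, Real.norm_eq_abs,
              abs_of_nonneg h0]
            exact mul_le_of_le_one_left (norm_nonneg c) h1
        · have : φ x = 0 := image_eq_zero_of_notMem_tsupport fun h => hxu (φ_supp h)
          have hxt : x ∉ t := fun h => hxu (tu h)
          simp [this, hxt]
    _ ≤ ‖c‖ₑ * μ (u \ s) := by
        rw [eLpNorm_indicator_const hmeas one_ne_zero ENNReal.one_ne_top]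
        simp
    _ ≤ ‖c‖ₑ * (η + η) := by
        gcongr
        calc μ (u \ s) ≤ μ (u \ t ∪ t \ s) := measure_mono (sdiff_triangle u t s)
          _ ≤ μ (u \ t) + μ (t \ s) := measure_union_le _ _
          _ ≤ η + η := add_le_add μu.le μs.le
    _ ≤ ε := hη

theorem denseRange_toL1 (μ : Measure G) [μ.IsHaarMeasure] [μ.Regular] :
    DenseRange (toL1 μ) := by
  intro F
  rw [EMetric.mem_closure_iff]
  intro ε hε
  obtain ⟨δ, hδ, hδε⟩ := exists_between hε
  obtain ⟨g, hg, hle, hgc, hgm⟩ :=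
    exists_hasCompactSupport_eLpNorm_one_sub_le (Lp.memLp F) hδ.ne'
  refine ⟨_, ⟨⟨⟨g, hgc⟩, hg⟩, rfl⟩, ?_⟩
  refine lt_of_le_of_lt ?_ hδε
  rw [Lp.edist_def]
  refine le_trans (le_of_eq ?_) hle
  refine eLpNorm_congr_ae (EventuallyEq.rfl.sub ?_)
  exact MemLp.coeFn_toLp hgm

end GroupAlgebraLemmas

/-! ### T_ξ on C_c(G): contractivity, compatibility with the operations, isometric lifts -/

section CovariantMapLemmas

variable {G : Type*} [Group G] [TopologicalSpace G] [IsTopologicalGroup G] [LocallyCompactSpace G]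
  [MeasurableSpace G] [BorelSpace G] {N : Subgroup G} [N.Normal]
  [MeasurableSpace (G ⧸ N)] [BorelSpace (G ⧸ N)]

theorem covMap_apply (hN : IsClosed (N : Set G)) (μN : Measure N) [μN.IsHaarMeasure]
    (ξ : N →ₜ* Circle) (μQ : Measure (G ⧸ N)) [μQ.IsHaarMeasure] (f : C_c(G, ℂ)) (x : G) :
    covMap hN μN ξ μQ f x = ∫ s : N, f (x * s) * conj (ξ s : ℂ) ∂μN := rfl

theorem covConv_apply {ξ : N →ₜ* Circle} {μQ : Measure (G ⧸ N)} [μQ.IsHaarMeasure]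
    (hξ : ξ ∈ invariantCharacters N) (ψ φ : CovFun ξ μQ) (x : G) :
    covConv hξ ψ φ x = cosetIntegral μQ fun y => ψ y * φ (y⁻¹ * x) := rfl

theorem covInvol_apply {ξ : N →ₜ* Circle} {μQ : Measure (G ⧸ N)} [μQ.IsHaarMeasure]
    (hξ : ξ ∈ invariantCharacters N) (ψ : CovFun ξ μQ) (x : G) :
    covInvol hξ ψ x = (modular ((x⁻¹ : G) : G ⧸ N) : ℂ) * conj (ψ x⁻¹) := rfl

/-- The absolute value of a compactly supported continuous function. -/
def absCc (f : C_c(G, ℂ)) : C_c(G, ℂ) where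
  toFun x := (‖f x‖ : ℂ)
  continuous_toFun := Complex.continuous_ofReal.comp (map_continuous f).norm
  hasCompactSupport' := f.hasCompactSupport.norm.comp_left Complex.ofReal_zero

/-- The product of a compactly supported continuous function and a continuous function. -/
def mulCc (f : C_c(G, ℂ)) {h : G → ℂ} (hh : Continuous h) : C_c(G, ℂ) where
  toFun x := f x * h x
  continuous_toFun := (map_continuous f).mul hh
  hasCompactSupport' := f.hasCompactSupport.mul_right

/-- Viewing the fibre integral of |f| as T_ξ(|f|) for the trivial character makes the continuity,
N-invariance and integrability known for covariant functions available for it. -/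
theorem covMap_one_absCc (hN : IsClosed (N : Set G)) (μN : Measure N) [μN.IsHaarMeasure]
    (μQ : Measure (G ⧸ N)) [μQ.IsHaarMeasure] (f : C_c(G, ℂ)) (x : G) :
    covMap hN μN 1 μQ (absCc f) x = ((∫ s : N, ‖f (x * s)‖ ∂μN : ℝ) : ℂ) := by
  rw [covMap_apply, ← integral_complex_ofReal]
  refine integral_congr_ae (Eventually.of_forall fun s => ?_)
  change (‖f (x * s)‖ : ℂ) * conj ((1 : Circle) : ℂ) = _
  rw [Circle.coe_one, map_one, mul_one]

theorem integrable_integral_norm_slice (hN : IsClosed (N : Set G)) (μN : Measure N)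
    [μN.IsHaarMeasure] (μQ : Measure (G ⧸ N)) [μQ.IsHaarMeasure] (f : C_c(G, ℂ)) :
    Integrable (fun z : G ⧸ N => ∫ s : N, ‖f (z.out * s)‖ ∂μN) μQ := by
  refine (covMap hN μN 1 μQ (absCc f)).integrable_norm_out.congr
    (Eventually.of_forall fun z => ?_)
  simp only
  rw [covMap_one_absCc, Complex.norm_real, Real.norm_of_nonneg]
  exact integral_nonneg fun _ => norm_nonneg _

theorem WeilFormula.integral_norm {μG : Measure G} {μN : Measure N} {μQ : Measure (G ⧸ N)}
    (hWeil : WeilFormula μG μN μQ) (f : C_c(G, ℂ)) :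
    cosetIntegral μQ (fun x => ∫ s : N, ‖f (x * s)‖ ∂μN) = ∫ x, ‖f x‖ ∂μG := by
  have h : cosetIntegral μQ (fun x => ∫ s : N, (‖f (x * s)‖ : ℂ) ∂μN)
      = ∫ x, (‖f x‖ : ℂ) ∂μG := hWeil (absCc f)
  simp only [cosetIntegral, integral_complex_ofReal] at h ⊢
  exact_mod_cast h

/-- Since |ξ| = 1, the triangle inequality on each fibre bounds |T_ξ(f)| by the fibre integral of
|f|, and Weil's formula integrates the latter to ‖f‖₁. -/
theorem norm_covMap_le (hN : IsClosed (N : Set G)) {μG : Measure G} {μN : Measure N}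
    [μN.IsHaarMeasure] (ξ : N →ₜ* Circle) {μQ : Measure (G ⧸ N)} [μQ.IsHaarMeasure]
    (hWeil : WeilFormula μG μN μQ) (f : C_c(G, ℂ)) :
    ‖covMap hN μN ξ μQ f‖ ≤ ∫ x, ‖f x‖ ∂μG := by
  rw [← hWeil.integral_norm, CovFun.norm_def]
  refine integral_mono (CovFun.integrable_norm_out _)
    (integrable_integral_norm_slice hN μN μQ f) fun z => ?_
  simp only [covMap_apply]
  refine (norm_integral_le_integral_norm _).trans (le_of_eq ?_)
  refine integral_congr_ae (Eventually.of_forall fun s => ?_)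
  simp only
  rw [norm_mul, RCLike.norm_conj, Circle.norm_coe, mul_one]

/-- `∫_G f h = ∫_{G/N} T_ξ(f) h` if `h(xs) = conj (ξ(s)) h(x)`. -/
theorem cosetIntegral_covMap_mul (hN : IsClosed (N : Set G)) {μG : Measure G} {μN : Measure N}
    [μN.IsHaarMeasure] {ξ : N →ₜ* Circle} {μQ : Measure (G ⧸ N)} [μQ.IsHaarMeasure]
    (hWeil : WeilFormula μG μN μQ) (f : C_c(G, ℂ)) {h : G → ℂ} (hh : Continuous h)
    (hcov : ∀ (x : G) (s : N), h (x * s) = conj (ξ s : ℂ) * h x) :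
    cosetIntegral μQ (fun x => covMap hN μN ξ μQ f x * h x) = ∫ x, f x * h x ∂μG := by
  refine Eq.trans ?_ (hWeil (mulCc f hh))
  congr 1
  funext x
  change _ = ∫ s : N, f (x * s) * h (x * s) ∂μN
  rw [covMap_apply, ← integral_mul_const]
  simp only [hcov, mul_assoc]

/-- Both sides at x equal ∫ f(y) T_ξ(g)(y⁻¹x) dy over G: the left one by exchanging the integrals
over N and G, the right one by unfolding G/N with Weil's formula. -/
theorem covMap_convCc (hN : IsClosed (N : Set G)) {μG : Measure G} [μG.IsHaarMeasure]
    {μN : Measure N} [μN.IsHaarMeasure] {ξ : N →ₜ* Circle} {μQ : Measure (G ⧸ N)}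
    [μQ.IsHaarMeasure] (hWeil : WeilFormula μG μN μQ) (hξ : ξ ∈ invariantCharacters N)
    (f g : C_c(G, ℂ)) :
    covMap hN μN ξ μQ (convCc μG f g)
      = covConv hξ (covMap hN μN ξ μQ f) (covMap hN μN ξ μQ g) := by
  refine DFunLike.ext _ _ fun x => ?_
  set ψ := covMap hN μN ξ μQ g with hψ
  -- Invariance of ξ enters here: s⁻¹ appears on the left of the argument of ψ, where covariance
  -- alone gives no information.
  have hcov : ∀ (y : G) (s : N), ψ ((y * s)⁻¹ * x) = conj (ξ s : ℂ) * ψ (y⁻¹ * x) := by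
    intro y s
    have h1 : ((y * s)⁻¹ * x : G) = ((s⁻¹ : N) : G) * (y⁻¹ * x) := by simp [mul_assoc]
    rw [h1, ψ.apply_left_mul hξ, map_inv, Circle.coe_inv_eq_conj]
  rw [covConv_apply, cosetIntegral_covMap_mul hN hWeil f (h := fun y => ψ (y⁻¹ * x))
    (ψ.continuous.comp (continuous_inv.mul continuous_const)) hcov]
  calc ∫ s : N, (∫ y, f y * g (y⁻¹ * (x * s)) ∂μG) * conj (ξ s : ℂ) ∂μN
      = ∫ s : N, (∫ y, f y * g (y⁻¹ * (x * s)) * conj (ξ s : ℂ) ∂μG) ∂μN := by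
        simp only [integral_mul_const]
    _ = ∫ y, (∫ s : N, f y * g (y⁻¹ * (x * s)) * conj (ξ s : ℂ) ∂μN) ∂μG := by
        have hx : Continuous fun p : N × G => (x * (p.1 : G), p.2) := by fun_prop
        refine integral_integral_swap_of_hasCompactSupport
          (f := fun (s : N) y => f y * g (y⁻¹ * (x * s)) * conj (ξ s : ℂ)) ?_ ?_
        · refine ((continuous_conv_integrand f g).comp hx).mul ?_
          exact Complex.continuous_conj.comp
            (continuous_subtype_val.comp ((map_continuous ξ).comp continuous_fst))
        · refine HasCompactSupport.intro
            (K := (((↑) : N → G) ⁻¹' ((x * ·) ⁻¹' (tsupport f * tsupport g))) ×ˢ tsupport f)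
            (IsCompact.prod (hN.isClosedEmbedding_subtypeVal.isCompact_preimage
              ((Homeomorph.mulLeft x).isClosedEmbedding.isCompact_preimage
              (IsCompact.mul f.hasCompactSupport g.hasCompactSupport))) f.hasCompactSupport) ?_
          rintro ⟨s, y⟩ hsy
          by_contra h
          have h1 : y ∈ tsupport f :=
            subset_tsupport _ (left_ne_zero_of_mul (left_ne_zero_of_mul h))
          have h2 : y⁻¹ * (x * s) ∈ tsupport g :=
            subset_tsupport _ (right_ne_zero_of_mul (left_ne_zero_of_mul h))
          exact hsy ⟨⟨y, h1, _, h2, by simp⟩, h1⟩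
    _ = ∫ y, f y * ψ (y⁻¹ * x) ∂μG := by
        refine integral_congr_ae (Eventually.of_forall fun y => ?_)
        simp only [mul_assoc]
        rw [integral_const_mul, hψ, covMap_apply]
        simp only [mul_assoc]

theorem CovFun.integrable_mul_conj_out {ξ : N →ₜ* Circle} {μQ : Measure (G ⧸ N)}
    [μQ.IsHaarMeasure] (ψ φ : CovFun ξ μQ) :
    Integrable (fun z : G ⧸ N => ψ z.out * conj (φ z.out)) μQ := by
  refine Continuous.integrable_of_hasCompactSupport ?_ ?_
  · refine continuous_out (F := fun x => ψ x * conj (φ x))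
      (ψ.continuous.mul (Complex.continuous_conj.comp φ.continuous)) fun x s => ?_
    have h : (ξ s : ℂ) * conj (ξ s : ℂ) = 1 := by
      rw [Complex.mul_conj, Circle.normSq_coe, Complex.ofReal_one]
    rw [ψ.isCovariant, φ.isCovariant, map_mul]
    linear_combination (ψ x * conj (φ x)) * h
  · exact HasCompactSupport.intro ψ.isCompact fun z hz => by rw [ψ.out_eq_zero z hz, zero_mul]

theorem CovFun.eq_zero_of_cosetIntegral_mul_conj_eq_zero {ξ : N →ₜ* Circle}
    {μQ : Measure (G ⧸ N)} [μQ.IsHaarMeasure] (ψ : CovFun ξ μQ)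
    (h : cosetIntegral μQ (fun x => ψ x * conj (ψ x)) = 0) : ψ = 0 := by
  have hcont : Continuous fun z : G ⧸ N => ‖ψ z.out‖ ^ 2 := ψ.continuous_norm_out.pow 2
  have hint : Integrable (fun z : G ⧸ N => ‖ψ z.out‖ ^ 2) μQ :=
    hcont.integrable_of_hasCompactSupport
      (ψ.hasCompactSupport_norm_out.comp_left (g := fun t => t ^ 2) (by simp))
  simp only [cosetIntegral, Complex.mul_conj'] at h
  norm_cast at h
  rw [integral_eq_zero_iff_of_nonneg (fun z => sq_nonneg _) hint] at h
  replace h := (hcont.ae_eq_iff_eq μQ continuous_const).1 h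
  refine norm_eq_zero.1 ?_
  rw [CovFun.norm_def, cosetIntegral]
  refine integral_eq_zero_of_ae (Eventually.of_forall fun z => ?_)
  exact pow_eq_zero_iff two_ne_zero |>.1 (congrFun h z)

/-- The difference φ of the two sides is covariant, so it vanishes once its pairing with itself
does. Paired with φ, each side becomes the conjugate of ∫ f(x) φ(x⁻¹) dx: for T_ξ(f^*) by unfolding
and then inverting on G, for T_ξ(f)^♮ by inverting on G/N and then unfolding. -/
theorem covMap_involCc (hN : IsClosed (N : Set G)) {μG : Measure G} [μG.IsHaarMeasure]
    {μN : Measure N} [μN.IsHaarMeasure] {ξ : N →ₜ* Circle} {μQ : Measure (G ⧸ N)}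
    [μQ.IsHaarMeasure] (hWeil : WeilFormula μG μN μQ) (hξ : ξ ∈ invariantCharacters N)
    (f : C_c(G, ℂ)) :
    covMap hN μN ξ μQ (involCc f) = covInvol hξ (covMap hN μN ξ μQ f) := by
  set ψ := covMap hN μN ξ μQ f
  rw [← sub_eq_zero]
  set φ := covMap hN μN ξ μQ (involCc f) - covInvol hξ ψ with hφ
  refine φ.eq_zero_of_cosetIntegral_mul_conj_eq_zero ?_
  have hφinv : ∀ (x : G) (s : N), φ (x * s)⁻¹ = conj (ξ s : ℂ) * φ x⁻¹ := fun x s => by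
    have h1 : ((x * s)⁻¹ : G) = ((s⁻¹ : N) : G) * x⁻¹ := by simp
    rw [h1, φ.apply_left_mul hξ, map_inv, Circle.coe_inv_eq_conj]
  have hφc : Continuous fun x => conj (φ x) := Complex.continuous_conj.comp φ.continuous
  have hφic : Continuous fun x => φ x⁻¹ := φ.continuous.comp continuous_inv
  have h1 : cosetIntegral μQ (fun x => covMap hN μN ξ μQ (involCc f) x * conj (φ x))
      = conj (∫ x, f x * φ x⁻¹ ∂μG) := by
    rw [cosetIntegral_covMap_mul hN hWeil (involCc f) hφc
      fun x s => by rw [φ.isCovariant, map_mul], ← integral_conj,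
      ← integral_modular_inv_smul_comp_inv μG (g := fun x => conj (f x * φ x⁻¹))
        (Complex.continuous_conj.comp ((map_continuous f).mul hφic))
        (HasCompactSupport.comp_left (g := conj) f.hasCompactSupport.mul_right (map_zero _))]
    refine integral_congr_ae (Eventually.of_forall fun x => ?_)
    simp only [involCc_apply, inv_inv, map_mul, Complex.real_smul, mul_assoc]
  have h2 : cosetIntegral μQ (fun x => covInvol hξ ψ x * conj (φ x))
      = conj (∫ x, f x * φ x⁻¹ ∂μG) := by
    have hk : ∀ (x : G) (s : N), conj (ψ (x * s) * φ (x * s)⁻¹) = conj (ψ x * φ x⁻¹) := by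
      intro x s
      have h : (ξ s : ℂ) * conj (ξ s : ℂ) = 1 := by
        rw [Complex.mul_conj, Circle.normSq_coe, Complex.ofReal_one]
      rw [ψ.isCovariant, hφinv]
      congr 1
      linear_combination (ψ x * φ x⁻¹) * h
    rw [← cosetIntegral_covMap_mul hN hWeil f hφic hφinv, cosetIntegral, cosetIntegral,
      ← integral_conj,
      ← integral_modular_inv_smul_comp_inv μQ (g := fun z : G ⧸ N => conj (ψ z.out * φ z.out⁻¹))
        (continuous_out (F := fun x => conj (ψ x * φ x⁻¹))
          (Complex.continuous_conj.comp (ψ.continuous.mul hφic)) hk)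
        (HasCompactSupport.intro ψ.isCompact fun z hz => by rw [ψ.out_eq_zero z hz]; simp)]
    refine integral_congr_ae (Eventually.of_forall fun z => ?_)
    -- The chosen representative of z⁻¹ need not be the inverse of that of z. Both lie in the same
    -- coset, on which the integrand is constant.
    have hz := apply_out (F := fun x => conj (ψ x * φ x⁻¹)) hk z.out⁻¹
    rw [QuotientGroup.mk_inv, QuotientGroup.out_eq'] at hz
    simp only at hz ⊢
    rw [hz, covInvol_apply, inv_inv, Complex.real_smul, QuotientGroup.mk_inv,
      QuotientGroup.out_eq', map_mul, mul_assoc]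
  have h3 : ∀ x, φ x = covMap hN μN ξ μQ (involCc f) x - covInvol hξ ψ x := fun x => by
    rw [hφ, sub_eq_add_neg, CovFun.add_apply, CovFun.neg_apply, sub_eq_add_neg]
  calc cosetIntegral μQ (fun x => φ x * conj (φ x))
      = cosetIntegral μQ (fun x => covMap hN μN ξ μQ (involCc f) x * conj (φ x))
        - cosetIntegral μQ (fun x => covInvol hξ ψ x * conj (φ x)) := by
        simp only [cosetIntegral]
        rw [← integral_sub (CovFun.integrable_mul_conj_out _ φ)
          (CovFun.integrable_mul_conj_out _ φ)]
        refine integral_congr_ae (Eventually.of_forall fun z => ?_)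
        simp only
        rw [← sub_mul, ← h3]
    _ = 0 := by rw [h1, h2, sub_self]

/-- The quotient map is open, so images of compact neighbourhoods in G are neighbourhoods in G/N;
finitely many of them cover K. -/
theorem exists_isCompact_subset_image_mk {K : Set (G ⧸ N)} (hK : IsCompact K) :
    ∃ C : Set G, IsCompact C ∧ K ⊆ ((↑) : G → G ⧸ N) '' C := by
  refine hK.induction_on (p := fun s => ∃ C : Set G, IsCompact C ∧ s ⊆ ((↑) : G → G ⧸ N) '' C)
    ⟨∅, isCompact_empty, by simp⟩ ?_ ?_ ?_
  · rintro s t hst ⟨C, hC, htC⟩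
    exact ⟨C, hC, hst.trans htC⟩
  · rintro s t ⟨C, hC, hsC⟩ ⟨D, hD, htD⟩
    refine ⟨C ∪ D, hC.union hD, ?_⟩
    rw [Set.image_union]
    exact Set.union_subset_union hsC htD
  · intro z _
    obtain ⟨x, rfl⟩ := QuotientGroup.mk_surjective z
    obtain ⟨C, hC, hxC⟩ := exists_compact_mem_nhds x
    exact ⟨_, mem_nhdsWithin_of_mem_nhds ((QuotientGroup.isOpenMap_coe (N := N)).image_mem_nhds hxC),
      C, hC, subset_rfl⟩

/-- The lift is f = g ψ / m, with m the fibre integral of g. As ψ / m is covariant, it factors out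
of the fibre integrals, so that T_ξ(f) = ψ. As g ≥ 0, the fibre integral of |f| is |ψ| exactly, with
no loss in the norm. -/
theorem exists_covMap_eq_integral_norm_eq (hN : IsClosed (N : Set G)) {μG : Measure G}
    {μN : Measure N} [μN.IsHaarMeasure] {ξ : N →ₜ* Circle} {μQ : Measure (G ⧸ N)}
    [μQ.IsHaarMeasure] (hWeil : WeilFormula μG μN μQ) (ψ : CovFun ξ μQ) :
    ∃ f : C_c(G, ℂ), covMap hN μN ξ μQ f = ψ ∧ ∫ x, ‖f x‖ ∂μG = ‖ψ‖ := by
  obtain ⟨C, hC, hψC⟩ := exists_isCompact_subset_image_mk ψ.isCompact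
  obtain ⟨g₀, g₀_one, g₀_comp, -, g₀_mem⟩ :=
    exists_continuousMap_one_of_isCompact_subset_isOpen hC isOpen_univ C.subset_univ
  let g : C_c(G, ℂ) := ⟨⟨fun x => (g₀ x : ℂ), Complex.continuous_ofReal.comp (map_continuous g₀)⟩,
    HasCompactSupport.comp_left (g := Complex.ofReal) g₀_comp Complex.ofReal_zero⟩
  have hg : ∀ x, ‖g x‖ = g₀ x := fun x => by
    change ‖(g₀ x : ℂ)‖ = _
    rw [Complex.norm_real, Real.norm_of_nonneg (g₀_mem x).1]
  have hg' : ∀ x, g x = (‖g x‖ : ℂ) := fun x => by rw [hg]; rfl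
  let m : G → ℝ := fun x => ∫ s : N, ‖g (x * s)‖ ∂μN
  have hm_eq : ∀ x, covMap hN μN 1 μQ (absCc g) x = (m x : ℂ) := covMap_one_absCc hN μN μQ g
  have hm_cont : Continuous fun x => (m x : ℂ) :=
    (covMap hN μN 1 μQ (absCc g)).continuous.congr hm_eq
  have hm_mul : ∀ (x : G) (s : N), m (x * s) = m x := fun x s => by
    have := (covMap hN μN 1 μQ (absCc g)).isCovariant x s
    rw [hm_eq, hm_eq, show (1 : N →ₜ* Circle) s = 1 from rfl, Circle.coe_one, one_mul] at this
    exact_mod_cast this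
  have hslice : ∀ x, Integrable (fun s : N => ‖g (x * s)‖) μN := fun x => by
    refine (integrable_slice hN μN ξ g x).norm.congr (Eventually.of_forall fun s => ?_)
    simp only
    rw [norm_mul, RCLike.norm_conj, Circle.norm_coe, mul_one]
  -- The coset of x meets C, where g = 1. A continuous nonnegative function with zero Haar integral
  -- would vanish identically on the fibre.
  have hm_pos : ∀ x ∈ tsupport ψ, m x ≠ 0 := by
    intro x hx hmx
    obtain ⟨c, hc, hcx⟩ := hψC ⟨x, hx, rfl⟩
    have hk : x⁻¹ * c ∈ N := QuotientGroup.eq.1 hcx.symm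
    have hcont : Continuous fun s : N => ‖g (x * s)‖ :=
      ((map_continuous g).comp (continuous_const.mul continuous_subtype_val)).norm
    have h := (integral_eq_zero_iff_of_nonneg (fun s => norm_nonneg _) (hslice x)).1 hmx
    have h0 := congrFun ((hcont.ae_eq_iff_eq μN continuous_const).1 h) ⟨x⁻¹ * c, hk⟩
    simp only [mul_inv_cancel_left, hg, g₀_one hc] at h0
    exact one_ne_zero h0
  -- Off supp ψ the quotient is locally 0, including where m vanishes, because division by zero
  -- gives 0.
  have hq_cont : Continuous fun x => ψ x / (m x : ℂ) := by
    refine continuous_iff_continuousAt.2 fun x => ?_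
    by_cases hx : x ∈ tsupport ψ
    · exact ψ.continuous.continuousAt.div hm_cont.continuousAt
        (Complex.ofReal_ne_zero.2 (hm_pos x hx))
    · refine (continuousAt_const (y := (0 : ℂ))).congr ?_
      filter_upwards [(isClosed_tsupport ψ).isOpen_compl.mem_nhds hx] with y hy
      rw [image_eq_zero_of_notMem_tsupport hy, zero_div]
  have hψm : ∀ x, ψ x / (m x : ℂ) * (m x : ℂ) = ψ x := fun x => by
    by_cases hx : x ∈ tsupport ψ
    · exact div_mul_cancel₀ _ (Complex.ofReal_ne_zero.2 (hm_pos x hx))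
    · rw [image_eq_zero_of_notMem_tsupport hx, zero_div, zero_mul]
  have hq_mul : ∀ (x : G) (s : N), ψ (x * s) / (m (x * s) : ℂ) = ξ s * (ψ x / (m x : ℂ)) :=
    fun x s => by rw [ψ.isCovariant, hm_mul, mul_div_assoc]
  refine ⟨mulCc g hq_cont, DFunLike.ext _ _ fun x => ?_, ?_⟩
  · calc ∫ s : N, g (x * s) * (ψ (x * s) / (m (x * s) : ℂ)) * conj (ξ s : ℂ) ∂μN
        = ∫ s : N, (ψ x / (m x : ℂ)) * (‖g (x * s)‖ : ℂ) ∂μN := by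
          refine integral_congr_ae (Eventually.of_forall fun s => ?_)
          have h : (ξ s : ℂ) * conj (ξ s : ℂ) = 1 := by
            rw [Complex.mul_conj, Circle.normSq_coe, Complex.ofReal_one]
          simp only
          rw [hq_mul, ← hg']
          linear_combination g (x * s) * (ψ x / (m x : ℂ)) * h
      _ = ψ x := by rw [integral_const_mul, integral_complex_ofReal, hψm]
  · rw [← hWeil.integral_norm, CovFun.norm_def]
    congr 1
    funext x
    calc ∫ s : N, ‖g (x * s) * (ψ (x * s) / (m (x * s) : ℂ))‖ ∂μN
        = ∫ s : N, ‖ψ x / (m x : ℂ)‖ * ‖g (x * s)‖ ∂μN := by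
          refine integral_congr_ae (Eventually.of_forall fun s => ?_)
          simp only
          rw [hq_mul, norm_mul, norm_mul, Circle.norm_coe, one_mul, mul_comm]
      _ = ‖ψ x / (m x : ℂ)‖ * ‖(m x : ℂ)‖ := by
          rw [integral_const_mul, Complex.norm_real, Real.norm_of_nonneg
            (integral_nonneg fun _ => norm_nonneg _)]
      _ = ‖ψ x‖ := by rw [← norm_mul, hψm]

end CovariantMapLemmas

/-! ### Extension of *-algebra operations from a dense core -/

section Abstract

/-- The data needed to extend the operations `b` and `s` of `A` continuously along the map `i` with
dense range to the structure of a Banach *-algebra. -/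
structure IsDenseStarCore {A X : Type*} [AddCommGroup A] [Module ℂ A] [NormedAddCommGroup X]
    [NormedSpace ℂ X] (i : A →ₗ[ℂ] X) (b : A → A → A) (s : A →ₗ⋆[ℂ] A) : Prop where
  dense : DenseRange i
  add_mul : ∀ f g h, b (f + g) h = b f h + b g h
  mul_add : ∀ f g h, b f (g + h) = b f g + b f h
  smul_mul : ∀ (t : ℂ) f g, b (t • f) g = t • b f g
  mul_smul : ∀ (t : ℂ) f g, b f (t • g) = t • b f g
  mul_assoc : ∀ f g h, b (b f g) h = b f (b g h)
  norm_mul_le : ∀ f g, ‖i (b f g)‖ ≤ ‖i f‖ * ‖i g‖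
  inv_inv : ∀ f, s (s f) = f
  inv_mul : ∀ f g, s (b f g) = b (s g) (s f)
  norm_inv_le : ∀ f, ‖i (s f)‖ ≤ ‖i f‖

namespace IsDenseStarCore

variable {A X : Type*} [AddCommGroup A] [Module ℂ A] [NormedAddCommGroup X] [NormedSpace ℂ X]
  {i : A →ₗ[ℂ] X} {b : A → A → A} {s : A →ₗ⋆[ℂ] A}

/-- The product is extended one variable at a time: b(f, ·) becomes an operator L f on X of norm at
most ‖i f‖, and then f ↦ L f extends as a bounded map into the Banach space of operators on X. -/
theorem exists_continuousBilin [CompleteSpace X] (h : IsDenseStarCore i b s) :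
    ∃ B : X →L[ℂ] X →L[ℂ] X, (∀ f g, B (i f) (i g) = i (b f g)) ∧
      ∀ x y, ‖B x y‖ ≤ ‖x‖ * ‖y‖ := by
  let m : A → A →ₗ[ℂ] X := fun f =>
    { toFun := fun g => i (b f g)
      map_add' := fun g k => by rw [h.mul_add, map_add]
      map_smul' := fun t g => by rw [h.mul_smul, map_smul]; rfl }
  have hm : ∀ f g, ‖m f g‖ ≤ ‖i f‖ * ‖i g‖ := h.norm_mul_le
  let L : A → X →L[ℂ] X := fun f => (m f).extendOfNorm i
  have hL : ∀ f g, L f (i g) = i (b f g) := fun f g =>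
    LinearMap.extendOfNorm_eq h.dense ⟨‖i f‖, hm f⟩ g
  have ext : ∀ {P Q : X →L[ℂ] X}, (∀ g, P (i g) = Q (i g)) → P = Q := fun {P Q} hPQ =>
    DFunLike.coe_injective (h.dense.equalizer P.continuous Q.continuous (funext hPQ))
  let L' : A →ₗ[ℂ] X →L[ℂ] X :=
    { toFun := L
      map_add' := fun f k => ext fun g => by
        rw [_root_.add_apply, hL, hL, hL, h.add_mul, map_add]
      map_smul' := fun t f => ext fun g => by
        rw [RingHom.id_apply, _root_.smul_apply, hL, hL, h.smul_mul, map_smul] }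
  have hL' : ∀ f, ‖L' f‖ ≤ 1 * ‖i f‖ := fun f => by
    rw [one_mul]
    exact LinearMap.opNorm_extendOfNorm_le h.dense (norm_nonneg _) (hm f)
  refine ⟨L'.extendOfNorm i, fun f g => ?_, fun x y => ?_⟩
  · rw [LinearMap.extendOfNorm_eq h.dense ⟨1, hL'⟩]
    exact hL f g
  · refine ((L'.extendOfNorm i x).le_opNorm y).trans ?_
    gcongr
    simpa using LinearMap.norm_extendOfNorm_apply_le h.dense 1 hL' x

theorem extendBilin_eq (h : IsDenseStarCore i b s) {B : X →L[ℂ] X →L[ℂ] X}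
    (hB : ∀ f g, B (i f) (i g) = i (b f g)) (x y : X) : extendBilin i b x y = B x y := by
  have hd : DenseRange (Prod.map i i) := h.dense.prodMap h.dense
  -- Density makes the filter proper, so its limit is unique and the default value of `limUnder`
  -- plays no role.
  have : (comap (Prod.map i i) (𝓝 (x, y))).NeBot := comap_neBot_iff.2 fun t ht => by
    obtain ⟨p, hp⟩ := hd.mem_nhds ht
    exact ⟨p, hp⟩
  refine Tendsto.limUnder_eq ?_
  have hc : Continuous fun p : X × X => B p.1 p.2 := by fun_prop
  refine ((hc.tendsto (x, y)).comp tendsto_comap).congr fun p => ?_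
  exact hB p.1 p.2

theorem extendBilin_apply [CompleteSpace X] (h : IsDenseStarCore i b s) (f g : A) :
    extendBilin i b (i f) (i g) = i (b f g) := by
  obtain ⟨B, hB, -⟩ := h.exists_continuousBilin
  rw [h.extendBilin_eq hB, hB]

theorem extendInv_apply [CompleteSpace X] (h : IsDenseStarCore i b s) (f : A) :
    (i.comp s).extendOfNorm i (i f) = i (s f) :=
  LinearMap.extendOfNorm_eq h.dense ⟨1, fun g => by simpa using h.norm_inv_le g⟩ f

theorem continuous_extendBilin [CompleteSpace X] (h : IsDenseStarCore i b s) :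
    Continuous fun p : X × X => extendBilin i b p.1 p.2 := by
  obtain ⟨B, hB, -⟩ := h.exists_continuousBilin
  simp only [h.extendBilin_eq hB]
  fun_prop

theorem isBanachStarAlgebra [CompleteSpace X] (h : IsDenseStarCore i b s) :
    IsBanachStarAlgebra X (extendBilin i b) ((i.comp s).extendOfNorm i) := by
  obtain ⟨B, hB, hBn⟩ := h.exists_continuousBilin
  have hI := h.extendInv_apply
  have hIn : ∀ x, ‖(i.comp s).extendOfNorm i x‖ ≤ ‖x‖ := fun x => by
    simpa using LinearMap.norm_extendOfNorm_apply_le (f := i.comp s) h.dense 1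
      (fun g => by simpa using h.norm_inv_le g) x
  have heq : extendBilin i b = fun x y => B x y :=
    funext fun x => funext fun y => h.extendBilin_eq hB x y
  rw [heq]
  set I := (i.comp s).extendOfNorm i
  have hII : ∀ x, I (I x) = x := fun x => by
    refine h.dense.induction_on (p := fun x => I (I x) = x) x
      (isClosed_eq (by fun_prop) continuous_id) fun f => ?_
    rw [hI, hI, h.inv_inv]
  exact
    { eq_zero_of_norm := fun _ => norm_eq_zero.1
      complete := inferInstance
      add_mul := fun x y z => by simp
      mul_add := fun x y z => by simp
      smul_mul := fun t x y => by simp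
      mul_smul := fun t x y => by simp
      mul_assoc := fun x y z => by
        refine h.dense.induction_on₃ (p := fun x y z => B (B x y) z = B x (B y z))
          (isClosed_eq (by fun_prop) (by fun_prop)) (fun f g k => ?_) x y z
        rw [hB, hB, hB, hB, h.mul_assoc]
      norm_mul_le := hBn
      inv_add := fun x y => map_add I x y
      inv_smul := fun t x => map_smulₛₗ I t x
      inv_inv := hII
      inv_mul := fun x y => by
        refine h.dense.induction_on₂ (p := fun x y => I (B x y) = B (I y) (I x))
          (isClosed_eq (by fun_prop) (by fun_prop)) (fun f g => ?_) x y
        rw [hB, hI, hI, hI, hB, h.inv_mul]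
      norm_inv := fun x => by
        -- Only contractivity is assumed; applied to I x together with I (I x) = x, it gives the
        -- reverse inequality.
        refine le_antisymm (hIn x) ?_
        simpa only [hII] using hIn (I x) }

/-- A dense core induces one on a quotient with isometric lifts. -/
theorem of_surjective {A' X' : Type*} [AddCommGroup A'] [Module ℂ A'] [NormedAddCommGroup X']
    [NormedSpace ℂ X'] {i' : A' →ₗ[ℂ] X'} {b' : A' → A' → A'} {s' : A' →ₗ⋆[ℂ] A'}
    (h : IsDenseStarCore i b s) (hd : DenseRange i') (T : A →ₗ[ℂ] A')
    (hT : ∀ f, ‖i' (T f)‖ ≤ ‖i f‖) (hlift : ∀ f', ∃ f, T f = f' ∧ ‖i f‖ = ‖i' f'‖)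
    (hmul : ∀ f g, T (b f g) = b' (T f) (T g)) (hinv : ∀ f, T (s f) = s' (T f)) :
    IsDenseStarCore i' b' s' where
  dense := hd
  add_mul f' g' k' := by
    obtain ⟨f, rfl, -⟩ := hlift f'
    obtain ⟨g, rfl, -⟩ := hlift g'
    obtain ⟨k, rfl, -⟩ := hlift k'
    rw [← map_add, ← hmul, h.add_mul, map_add, hmul, hmul]
  mul_add f' g' k' := by
    obtain ⟨f, rfl, -⟩ := hlift f'
    obtain ⟨g, rfl, -⟩ := hlift g'
    obtain ⟨k, rfl, -⟩ := hlift k'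
    rw [← map_add, ← hmul, h.mul_add, map_add, hmul, hmul]
  smul_mul t f' g' := by
    obtain ⟨f, rfl, -⟩ := hlift f'
    obtain ⟨g, rfl, -⟩ := hlift g'
    rw [← map_smul, ← hmul, h.smul_mul, map_smul, hmul]
  mul_smul t f' g' := by
    obtain ⟨f, rfl, -⟩ := hlift f'
    obtain ⟨g, rfl, -⟩ := hlift g'
    rw [← map_smul, ← hmul, h.mul_smul, map_smul, hmul]
  mul_assoc f' g' k' := by
    obtain ⟨f, rfl, -⟩ := hlift f'
    obtain ⟨g, rfl, -⟩ := hlift g'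
    obtain ⟨k, rfl, -⟩ := hlift k'
    rw [← hmul, ← hmul, ← hmul, ← hmul, h.mul_assoc]
  norm_mul_le f' g' := by
    obtain ⟨f, rfl, hf⟩ := hlift f'
    obtain ⟨g, rfl, hg⟩ := hlift g'
    -- Lifts of exactly equal norm are essential here: a loss in lifting would spoil the constant 1
    -- in submultiplicativity.
    rw [← hmul, ← hf, ← hg]
    exact (hT _).trans (h.norm_mul_le f g)
  inv_inv f' := by
    obtain ⟨f, rfl, -⟩ := hlift f'
    rw [← hinv, ← hinv, h.inv_inv]
  inv_mul f' g' := by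
    obtain ⟨f, rfl, -⟩ := hlift f'
    obtain ⟨g, rfl, -⟩ := hlift g'
    rw [← hmul, ← hinv, h.inv_mul, hmul, hinv, hinv]
  norm_inv_le f' := by
    obtain ⟨f, rfl, hf⟩ := hlift f'
    rw [← hinv, ← hf]
    exact (hT _).trans (h.norm_inv_le f)

end IsDenseStarCore

/-! ### Quotient maps of Banach spaces and quotient *-algebras -/

/-- A continuous linear map that admits isometric lifts over a dense subspace is a quotient map of
Banach spaces. -/
theorem exists_preimage_norm_le_of_dense {X Y : Type*} [NormedAddCommGroup X] [NormedSpace ℂ X]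
    [CompleteSpace X] [NormedAddCommGroup Y] [NormedSpace ℂ Y] (T : X →L[ℂ] Y)
    {K : AddSubgroup Y} (hK : Dense (K : Set Y)) (hlift : ∀ y ∈ K, ∃ x, T x = y ∧ ‖x‖ ≤ ‖y‖)
    {ε : ℝ} (hε : 0 < ε) (y : Y) : ∃ x, T x = y ∧ ‖x‖ ≤ (1 + ε) * ‖y‖ := by
  let T' : NormedAddGroupHom X Y := T.toLinearMap.toAddMonoidHom.mkNormedAddGroupHom ‖T‖ T.le_opNorm
  have h : T'.SurjectiveOnWith K 1 := fun y hy => by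
    rw [one_mul]
    exact hlift y hy
  -- Successive approximation: y is a rapidly convergent sum of elements of K, and the sum of their
  -- lifts converges because X is complete. The correction terms cost the factor 1 + ε.
  exact controlled_closure_of_complete one_pos hε h y (hK y)

/-- The isometry of `X ⧸ ker T` onto `Y` for a quotient map `T` of Banach spaces. -/
def quotKerIsometryEquiv {X Y : Type*} [NormedAddCommGroup X] [NormedSpace ℂ X]
    [NormedAddCommGroup Y] [NormedSpace ℂ Y] (T : X →L[ℂ] Y) (hT : ∀ x, ‖T x‖ ≤ ‖x‖)
    (hlift : ∀ ε : ℝ, 0 < ε → ∀ y, ∃ x, T x = y ∧ ‖x‖ ≤ (1 + ε) * ‖y‖) :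
    (X ⧸ LinearMap.ker T.toLinearMap) ≃ₗᵢ[ℂ] Y where
  toLinearEquiv := LinearMap.quotKerEquivOfSurjective T.toLinearMap
    fun y => (hlift 1 one_pos y).imp fun _ => And.left
  norm_map' p := by
    refine le_antisymm ?_ ?_
    · refine le_of_forall_pos_le_add fun ε hε => ?_
      obtain ⟨x, rfl, hx⟩ := Submodule.Quotient.norm_mk_lt p hε
      exact (hT x).trans hx.le
    · obtain ⟨x, rfl⟩ := Submodule.Quotient.mk_surjective _ p
      change _ ≤ ‖T x‖
      have key : ∀ ε : ℝ, 0 < ε →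
          ‖(Submodule.Quotient.mk x : X ⧸ LinearMap.ker T.toLinearMap)‖ ≤ (1 + ε) * ‖T x‖ := by
        intro ε hε
        obtain ⟨x', hx', hn⟩ := hlift ε hε (T x)
        have : (Submodule.Quotient.mk x : X ⧸ LinearMap.ker T.toLinearMap)
            = Submodule.Quotient.mk x' := by
          rw [Submodule.Quotient.eq, LinearMap.mem_ker, map_sub]
          exact sub_eq_zero.2 hx'.symm
        rw [this]
        exact (Submodule.Quotient.norm_mk_le _ x').trans hn
      -- No lift of norm exactly ‖T x‖ need exist in X, but the quotient norm is an infimum, so ε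
      -- may tend to 0.
      have hlim : Tendsto (fun ε : ℝ => (1 + ε) * ‖T x‖) (𝓝[>] 0) (𝓝 ((1 + 0) * ‖T x‖)) :=
        ((continuous_const.add continuous_id).mul continuous_const).continuousWithinAt
      rw [add_zero, one_mul] at hlim
      exact ge_of_tendsto hlim (eventually_mem_nhdsWithin.mono key)

/-- Transport of structure. A is only seminormed because it will be a quotient by a submodule;
definiteness of its norm is part of what is transported. -/
theorem IsBanachStarAlgebra.of_linearIsometryEquiv {A B : Type*} [SeminormedAddCommGroup A]
    [NormedSpace ℂ A] [NormedAddCommGroup B] [NormedSpace ℂ B] {mulA : A → A → A} {invA : A → A}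
    {mulB : B → B → B} {invB : B → B} (hB : IsBanachStarAlgebra B mulB invB) (Φ : A ≃ₗᵢ[ℂ] B)
    (hmul : ∀ a b, Φ (mulA a b) = mulB (Φ a) (Φ b)) (hinv : ∀ a, Φ (invA a) = invB (Φ a)) :
    IsBanachStarAlgebra A mulA invA where
  eq_zero_of_norm a ha := Φ.toLinearEquiv.map_eq_zero_iff.1 (norm_eq_zero.1 ((Φ.norm_map a).trans ha))
  complete := by
    have := hB.complete
    exact (Φ.isometry.isUniformInducing.completeSpace_congr Φ.surjective).2 this
  add_mul a b c := Φ.toLinearEquiv.injective (by simp [hmul, hB.add_mul])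
  mul_add a b c := Φ.toLinearEquiv.injective (by simp [hmul, hB.mul_add])
  smul_mul t a b := Φ.toLinearEquiv.injective (by simp [hmul, hB.smul_mul])
  mul_smul t a b := Φ.toLinearEquiv.injective (by simp [hmul, hB.mul_smul])
  mul_assoc a b c := Φ.toLinearEquiv.injective (by simp [hmul, hB.mul_assoc])
  norm_mul_le a b := by
    rw [← Φ.norm_map, ← Φ.norm_map a, ← Φ.norm_map b, hmul]
    exact hB.norm_mul_le _ _
  inv_add a b := Φ.toLinearEquiv.injective (by simp [hinv, hB.inv_add])
  inv_smul t a := Φ.toLinearEquiv.injective (by simp [hinv, hB.inv_smul])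
  inv_inv a := Φ.toLinearEquiv.injective (by simp [hinv, hB.inv_inv])
  inv_mul a b := Φ.toLinearEquiv.injective (by simp [hinv, hmul, hB.inv_mul])
  norm_inv a := by
    rw [← Φ.norm_map, ← Φ.norm_map a, hinv]
    exact hB.norm_inv _

section Kernel

variable {X Y : Type*} [NormedAddCommGroup X] [NormedSpace ℂ X] [NormedAddCommGroup Y]
  [NormedSpace ℂ Y] {mulX : X → X → X} {invX : X → X} {mulY : Y → Y → Y} {invY : Y → Y}
  {T : X →L[ℂ] Y}

theorem mk_ker_eq_iff {x y : X} :
    (Submodule.Quotient.mk x : X ⧸ LinearMap.ker T.toLinearMap) = Submodule.Quotient.mk y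
      ↔ T x = T y := by
  rw [Submodule.Quotient.eq, LinearMap.mem_ker, map_sub, sub_eq_zero]
  rfl

theorem apply_quotient_out (x : X) :
    T (Quotient.out (Submodule.Quotient.mk x : X ⧸ LinearMap.ker T.toLinearMap)) = T x :=
  mk_ker_eq_iff.1 (Quotient.out_eq _)

theorem IsContractiveStarHom.isClosedStarIdeal_ker
    (h : IsContractiveStarHom mulX invX mulY invY T.toLinearMap)
    (hY : IsBanachStarAlgebra Y mulY invY) :
    IsClosedStarIdeal mulX invX (LinearMap.ker T.toLinearMap) where
  isClosed := T.isClosed_ker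
  mul_mem_left a b hb := by
    rw [LinearMap.mem_ker] at hb ⊢
    rw [h.map_mul, hb]
    -- The product is a bare function, so y · 0 = 0 is read off from homogeneity with the scalar 0.
    simpa using hY.mul_smul 0 (T.toLinearMap a) 0
  mul_mem_right a ha b := by
    rw [LinearMap.mem_ker] at ha ⊢
    rw [h.map_mul, ha]
    simpa using hY.smul_mul 0 0 (T.toLinearMap b)
  inv_mem a ha := by
    rw [LinearMap.mem_ker] at ha ⊢
    rw [h.map_inv, ha]
    simpa using hY.inv_smul 0 0

/-- Independence of the chosen representatives: classes modulo the kernel are determined by their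
value under T, and T(xy) depends only on T(x) and T(y). -/
theorem IsContractiveStarHom.quotientMul_mk
    (h : IsContractiveStarHom mulX invX mulY invY T.toLinearMap) (x y : X) :
    quotientMul mulX (LinearMap.ker T.toLinearMap) (Submodule.Quotient.mk x)
      (Submodule.Quotient.mk y) = Submodule.Quotient.mk (mulX x y) := by
  refine mk_ker_eq_iff.2 ((h.map_mul _ _).trans ?_)
  refine Eq.trans ?_ (h.map_mul x y).symm
  exact congrArg₂ mulY (apply_quotient_out x) (apply_quotient_out y)

theorem IsContractiveStarHom.quotientInv_mk
    (h : IsContractiveStarHom mulX invX mulY invY T.toLinearMap) (x : X) :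
    quotientInv invX (LinearMap.ker T.toLinearMap) (Submodule.Quotient.mk x)
      = Submodule.Quotient.mk (invX x) := by
  refine mk_ker_eq_iff.2 ((h.map_inv _).trans ?_)
  refine Eq.trans ?_ (h.map_inv x).symm
  exact congrArg invY (apply_quotient_out x)

end Kernel

end Abstract

/-! ### Application to L¹(G), L¹_ξ(G, N) and T_ξ -/

section MainLemmas

variable {G : Type*} [Group G] [TopologicalSpace G] [IsTopologicalGroup G] [LocallyCompactSpace G]
  [MeasurableSpace G] [BorelSpace G] {N : Subgroup G} [N.Normal]
  [MeasurableSpace (G ⧸ N)] [BorelSpace (G ⧸ N)]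

theorem isDenseStarCore_convCc (μ : Measure G) [μ.IsHaarMeasure] [μ.Regular] :
    IsDenseStarCore (toL1 μ) (convCc μ) (involCc (G := G)) where
  dense := denseRange_toL1 μ
  add_mul := convCc_add_left μ
  mul_add := convCc_add_right μ
  smul_mul := convCc_smul_left μ
  mul_smul := convCc_smul_right μ
  mul_assoc := convCc_assoc μ
  norm_mul_le f g := by
    simp only [norm_toL1]
    exact integral_norm_convCc_le μ f g
  inv_inv := involCc_involCc
  inv_mul := involCc_convCc μ
  norm_inv_le f := by
    simp only [norm_toL1]
    exact (integral_norm_involCc μ f).le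

theorem norm_toCovL1 {ξ : N →ₜ* Circle} {μQ : Measure (G ⧸ N)} [μQ.IsHaarMeasure]
    (ψ : CovFun ξ μQ) : ‖toCovL1 ξ μQ ψ‖ = ‖ψ‖ :=
  UniformSpace.Completion.norm_coe ψ

theorem denseRange_toCovL1 (ξ : N →ₜ* Circle) (μQ : Measure (G ⧸ N)) [μQ.IsHaarMeasure] :
    DenseRange (toCovL1 ξ μQ) :=
  UniformSpace.Completion.denseRange_coe

theorem norm_toCovL1_covMap_le (hN : IsClosed (N : Set G)) {μG : Measure G} [μG.IsHaarMeasure]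
    {μN : Measure N} [μN.IsHaarMeasure] (ξ : N →ₜ* Circle) {μQ : Measure (G ⧸ N)}
    [μQ.IsHaarMeasure] (hWeil : WeilFormula μG μN μQ) (f : C_c(G, ℂ)) :
    ‖toCovL1 ξ μQ (covMap hN μN ξ μQ f)‖ ≤ ‖toL1 μG f‖ := by
  rw [norm_toCovL1, norm_toL1]
  exact norm_covMap_le hN ξ hWeil f

theorem exists_covMap_eq_norm_toL1_eq (hN : IsClosed (N : Set G)) {μG : Measure G}
    [μG.IsHaarMeasure] {μN : Measure N} [μN.IsHaarMeasure] {ξ : N →ₜ* Circle}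
    {μQ : Measure (G ⧸ N)} [μQ.IsHaarMeasure] (hWeil : WeilFormula μG μN μQ) (ψ : CovFun ξ μQ) :
    ∃ f : C_c(G, ℂ), covMap hN μN ξ μQ f = ψ ∧ ‖toL1 μG f‖ = ‖toCovL1 ξ μQ ψ‖ := by
  obtain ⟨f, hf, hn⟩ := exists_covMap_eq_integral_norm_eq hN hWeil ψ
  exact ⟨f, hf, by rw [norm_toL1, norm_toCovL1, hn]⟩

/-- No axiom is checked by integrating over G/N: associativity, submultiplicativity and the rules
for the involution all descend from C_c(G) along T_ξ. -/
theorem isDenseStarCore_covConv (hN : IsClosed (N : Set G)) {μG : Measure G} [μG.IsHaarMeasure]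
    [μG.Regular] {μN : Measure N} [μN.IsHaarMeasure] {ξ : N →ₜ* Circle}
    {μQ : Measure (G ⧸ N)} [μQ.IsHaarMeasure] (hWeil : WeilFormula μG μN μQ)
    (hξ : ξ ∈ invariantCharacters N) :
    IsDenseStarCore (toCovL1 ξ μQ) (covConv hξ) (covInvol hξ) :=
  (isDenseStarCore_convCc μG).of_surjective (denseRange_toCovL1 ξ μQ) (covMap hN μN ξ μQ)
    (norm_toCovL1_covMap_le hN ξ hWeil) (exists_covMap_eq_norm_toL1_eq hN hWeil)
    (covMap_convCc hN hWeil hξ) (covMap_involCc hN hWeil hξ)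

theorem covMapL1_toL1 (hN : IsClosed (N : Set G)) {μG : Measure G} [μG.IsHaarMeasure]
    [μG.Regular] {μN : Measure N} [μN.IsHaarMeasure] (ξ : N →ₜ* Circle)
    {μQ : Measure (G ⧸ N)} [μQ.IsHaarMeasure] (hWeil : WeilFormula μG μN μQ) (f : C_c(G, ℂ)) :
    covMapL1 hN μG μN ξ μQ (toL1 μG f) = toCovL1 ξ μQ (covMap hN μN ξ μQ f) :=
  LinearMap.extendOfNorm_eq (denseRange_toL1 μG)
    ⟨1, fun g => by simpa using norm_toCovL1_covMap_le hN ξ hWeil g⟩ f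

theorem norm_covMapL1_le (hN : IsClosed (N : Set G)) {μG : Measure G} [μG.IsHaarMeasure]
    [μG.Regular] {μN : Measure N} [μN.IsHaarMeasure] (ξ : N →ₜ* Circle)
    {μQ : Measure (G ⧸ N)} [μQ.IsHaarMeasure] (hWeil : WeilFormula μG μN μQ) (F : Lp ℂ 1 μG) :
    ‖covMapL1 hN μG μN ξ μQ F‖ ≤ ‖F‖ := by
  rw [← one_mul ‖F‖]
  exact LinearMap.norm_extendOfNorm_apply_le
    (f := (toCovL1 ξ μQ).comp (covMap hN μN ξ μQ)) (denseRange_toL1 μG) 1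
    (fun g => by simpa using norm_toCovL1_covMap_le hN ξ hWeil g) F

theorem exists_covMapL1_eq_norm_le (hN : IsClosed (N : Set G)) {μG : Measure G}
    [μG.IsHaarMeasure] [μG.Regular] {μN : Measure N} [μN.IsHaarMeasure] (ξ : N →ₜ* Circle)
    {μQ : Measure (G ⧸ N)} [μQ.IsHaarMeasure] (hWeil : WeilFormula μG μN μQ) (ε : ℝ) (hε : 0 < ε)
    (Y : CovL1 ξ μQ) : ∃ F, covMapL1 hN μG μN ξ μQ F = Y ∧ ‖F‖ ≤ (1 + ε) * ‖Y‖ := by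
  refine exists_preimage_norm_le_of_dense (covMapL1 hN μG μN ξ μQ)
    (K := (toCovL1 ξ μQ).toAddMonoidHom.range) (denseRange_toCovL1 ξ μQ) ?_ hε Y
  rintro _ ⟨ψ, rfl⟩
  obtain ⟨f, rfl, hn⟩ := exists_covMap_eq_norm_toL1_eq hN hWeil ψ
  exact ⟨toL1 μG f, covMapL1_toL1 hN ξ hWeil f, hn.le⟩

/-- The products are jointly continuous, so both identities are closed conditions and need checking
only on the dense image of C_c(G). -/
theorem isContractiveStarHom_covMapL1 (hN : IsClosed (N : Set G)) {μG : Measure G}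
    [μG.IsHaarMeasure] [μG.Regular] {μN : Measure N} [μN.IsHaarMeasure] {ξ : N →ₜ* Circle}
    {μQ : Measure (G ⧸ N)} [μQ.IsHaarMeasure] (hWeil : WeilFormula μG μN μQ)
    (hξ : ξ ∈ invariantCharacters N) :
    IsContractiveStarHom (convL1 μG) (involL1 μG) (covConvL1 hξ) (covInvolL1 hξ)
      (covMapL1 hN μG μN ξ μQ).toLinearMap := by
  have hG := isDenseStarCore_convCc μG
  have hQ := isDenseStarCore_covConv hN hWeil hξ
  have hd := denseRange_toL1 μG
  have hT := covMapL1_toL1 hN ξ hWeil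
  set T := covMapL1 hN μG μN ξ μQ
  have hcG : Continuous fun p : Lp ℂ 1 μG × Lp ℂ 1 μG => convL1 μG p.1 p.2 :=
    hG.continuous_extendBilin
  have hcQ : Continuous fun p : CovL1 ξ μQ × CovL1 ξ μQ => covConvL1 hξ p.1 p.2 :=
    hQ.continuous_extendBilin
  refine ⟨norm_covMapL1_le hN ξ hWeil, fun F H => ?_, fun F => ?_⟩
  · refine hd.induction_on₂ (p := fun F H => T (convL1 μG F H) = covConvL1 hξ (T F) (T H))
      (isClosed_eq (T.continuous.comp hcG) (hcQ.comp (T.continuous.prodMap T.continuous)))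
      (fun f g => ?_) F H
    have h1 : convL1 μG (toL1 μG f) (toL1 μG g) = _ := hG.extendBilin_apply f g
    have h2 : covConvL1 hξ (toCovL1 ξ μQ (covMap hN μN ξ μQ f))
      (toCovL1 ξ μQ (covMap hN μN ξ μQ g)) = _ := hQ.extendBilin_apply _ _
    rw [h1, hT, hT, hT, h2, covMap_convCc hN hWeil hξ]
  · refine hd.induction_on (p := fun F => T (involL1 μG F) = covInvolL1 hξ (T F)) F
      (isClosed_eq (by fun_prop) (by fun_prop)) fun f => ?_
    have h1 : involL1 μG (toL1 μG f) = _ := hG.extendInv_apply f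
    have h2 : covInvolL1 hξ (toCovL1 ξ μQ (covMap hN μN ξ μQ f)) = _ := hQ.extendInv_apply _
    rw [h1, hT, hT, h2, covMap_involCc hN hWeil hξ]

end MainLemmas

end CovariantAlgebra

end

open CovariantAlgebra

theorem mainTheorem8 {G : Type*} [Group G] [TopologicalSpace G] [IsTopologicalGroup G]
    [LocallyCompactSpace G] [T2Space G] [MeasurableSpace G] [BorelSpace G]
    (N : Subgroup G) [N.Normal] (hN : IsClosed (N : Set G))
    [MeasurableSpace (G ⧸ N)] [BorelSpace (G ⧸ N)]
    (μG : Measure G) [μG.IsHaarMeasure] [μG.Regular]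
    (μN : Measure N) [μN.IsHaarMeasure] [μN.Regular]
    (μQ : Measure (G ⧸ N)) [μQ.IsHaarMeasure] [μQ.Regular]
    (hWeil : WeilFormula μG μN μQ)
    (ξ : N →ₜ* Circle) (hξ : ξ ∈ invariantCharacters N) :
    -- the operations on `L¹(G)` and `L¹_ξ(G, N)` and the operator `T_ξ` extend the ones given by
    -- the integral formulas on `C_c(G)` and `C_ξ(G, N)`
    (∀ f g : C_c(G, ℂ), convL1 μG (toL1 μG f) (toL1 μG g) = toL1 μG (convCc μG f g)) ∧
    (∀ f : C_c(G, ℂ), involL1 μG (toL1 μG f) = toL1 μG (involCc f)) ∧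
    (∀ ψ φ : CovFun ξ μQ, covConvL1 hξ (toCovL1 ξ μQ ψ) (toCovL1 ξ μQ φ)
      = toCovL1 ξ μQ (covConv hξ ψ φ)) ∧
    (∀ ψ : CovFun ξ μQ, covInvolL1 hξ (toCovL1 ξ μQ ψ) = toCovL1 ξ μQ (covInvol hξ ψ)) ∧
    (∀ f : C_c(G, ℂ), covMapL1 hN μG μN ξ μQ (toL1 μG f)
      = toCovL1 ξ μQ (covMap hN μN ξ μQ f)) ∧
    -- (1) `T_ξ` is a contractive *-homomorphism of Banach *-algebras
    IsBanachStarAlgebra (Lp ℂ 1 μG) (convL1 μG) (involL1 μG) ∧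
    IsBanachStarAlgebra (CovL1 ξ μQ) (covConvL1 hξ) (covInvolL1 hξ) ∧
    IsContractiveStarHom (convL1 μG) (involL1 μG) (covConvL1 hξ) (covInvolL1 hξ)
      (covMapL1 hN μG μN ξ μQ).toLinearMap ∧
    -- (2) its kernel is a closed *-ideal
    IsClosedStarIdeal (convL1 μG) (involL1 μG) (covKer hN μG μN ξ μQ) ∧
    -- (3) `L¹_ξ(G, N)` is isometrically *-isomorphic to the quotient Banach *-algebra, through the
    -- map induced by `T_ξ`
    (∀ F H : Lp ℂ 1 μG, quotientMul (convL1 μG) (covKer hN μG μN ξ μQ)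
        (Submodule.Quotient.mk F) (Submodule.Quotient.mk H)
      = Submodule.Quotient.mk (convL1 μG F H)) ∧
    (∀ F : Lp ℂ 1 μG, quotientInv (involL1 μG) (covKer hN μG μN ξ μQ)
        (Submodule.Quotient.mk F) = Submodule.Quotient.mk (involL1 μG F)) ∧
    IsBanachStarAlgebra (Lp ℂ 1 μG ⧸ covKer hN μG μN ξ μQ)
      (quotientMul (convL1 μG) (covKer hN μG μN ξ μQ))
      (quotientInv (involL1 μG) (covKer hN μG μN ξ μQ)) ∧
    ∃ Φ : (Lp ℂ 1 μG ⧸ covKer hN μG μN ξ μQ) ≃ₗᵢ[ℂ] CovL1 ξ μQ,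
      (∀ F : Lp ℂ 1 μG, Φ (Submodule.Quotient.mk F) = covMapL1 hN μG μN ξ μQ F) ∧
      (∀ p q, Φ (quotientMul (convL1 μG) (covKer hN μG μN ξ μQ) p q)
        = covConvL1 hξ (Φ p) (Φ q)) ∧
      (∀ p, Φ (quotientInv (involL1 μG) (covKer hN μG μN ξ μQ) p)
        = covInvolL1 hξ (Φ p)) := by
  have hG := isDenseStarCore_convCc μG
  have hQ := isDenseStarCore_covConv hN hWeil hξ
  have hQB : IsBanachStarAlgebra (CovL1 ξ μQ) (covConvL1 hξ) (covInvolL1 hξ) :=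
    hQ.isBanachStarAlgebra
  have hT := isContractiveStarHom_covMapL1 hN hWeil hξ
  let Φ : (Lp ℂ 1 μG ⧸ covKer hN μG μN ξ μQ) ≃ₗᵢ[ℂ] CovL1 ξ μQ :=
    quotKerIsometryEquiv (covMapL1 hN μG μN ξ μQ) (norm_covMapL1_le hN ξ hWeil)
      (exists_covMapL1_eq_norm_le hN ξ hWeil)
  have hΦ : ∀ F : Lp ℂ 1 μG, Φ (Submodule.Quotient.mk F) = covMapL1 hN μG μN ξ μQ F :=
    fun _ => rfl
  have hmul : ∀ F H : Lp ℂ 1 μG, quotientMul (convL1 μG) (covKer hN μG μN ξ μQ)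
      (Submodule.Quotient.mk F) (Submodule.Quotient.mk H)
      = Submodule.Quotient.mk (convL1 μG F H) := hT.quotientMul_mk
  have hinv : ∀ F : Lp ℂ 1 μG, quotientInv (involL1 μG) (covKer hN μG μN ξ μQ)
      (Submodule.Quotient.mk F) = Submodule.Quotient.mk (involL1 μG F) := hT.quotientInv_mk
  have hΦmul : ∀ p q, Φ (quotientMul (convL1 μG) (covKer hN μG μN ξ μQ) p q)
      = covConvL1 hξ (Φ p) (Φ q) := fun p q => by
    obtain ⟨F, rfl⟩ := Submodule.Quotient.mk_surjective _ p
    obtain ⟨H, rfl⟩ := Submodule.Quotient.mk_surjective _ q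
    rw [hmul, hΦ, hΦ, hΦ]
    exact hT.map_mul F H
  have hΦinv : ∀ p, Φ (quotientInv (involL1 μG) (covKer hN μG μN ξ μQ) p)
      = covInvolL1 hξ (Φ p) := fun p => by
    obtain ⟨F, rfl⟩ := Submodule.Quotient.mk_surjective _ p
    rw [hinv, hΦ, hΦ]
    exact hT.map_inv F
  -- The Banach *-algebra structure of the quotient is pulled back from L¹_ξ(G, N) along the
  -- isometry `Φ`.
  exact ⟨hG.extendBilin_apply, hG.extendInv_apply, hQ.extendBilin_apply, hQ.extendInv_apply,
    covMapL1_toL1 hN ξ hWeil, hG.isBanachStarAlgebra, hQB, hT, hT.isClosedStarIdeal_ker hQB,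
    hmul, hinv, hQB.of_linearIsometryEquiv Φ hΦmul hΦinv, Φ, hΦ, hΦmul, hΦinv⟩
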